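/- Let $n,k$ be positive integers. Let $B_n$ be the group of signed permutations, i.e. the permutations of $\{\pm1,\dots,\pm n\}$ commuting with $x\mapsto -x$, with simple generators $s_i=(i,i+1)(-i,-(i+1))$ for $1\le i<n$ and $s_n=(n,-n)$, and let $T$ be the set of all conjugates of $s_1,\dots,s_n$. Let $\ell_T(w)$ be the least length of a word in $T$ with product $w$, write $u\le_T v$ if $\ell_T(v)=\ell_T(u)+\ell_T(u^{-1}v)$, and let $c$ be any Coxeter element of $B_n$ (a conjugate of a product of $s_1,\dots,s_n$, each taken once, in some order). Let $NC^{(k)}(B_n)$ be the set of all sequences $\pi=(\pi_1,\dots,\pi_k)$ in $B_n$ with $1\le_T\pi_1\le_T\pi_2\le_T\cdots\le_T\pi_k\le_T c$. It is ordered by: $\pi\le\mu$ if and only if $\mu_i^{-1}\mu_{i+1}\le_T\pi_i^{-1}\pi_{i+1}$ for all $1\le i\le k$, where $\pi_{k+1}=\mu_{k+1}=c$. Its rank function is $\mathrm{rk}(\pi)=\ell_T(\pi_1)$. For a positive integer $\ell$, an $\ell$-multichain in a poset is a sequence $P_1\le P_2\le\cdots\le P_\ell$ of its elements. The rank-jump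 vector of an $\ell$-multichain in $NC^{(k)}(B_n)$ is $$(r_1-0,\;r_2-r_1,\;\dots,\;r_\ell-r_{\ell-1},\;n-r_\ell),\qquad r_i=\mathrm{rk}(P_i).$$ (1) For all $\ell\ge1$ and all nonnegative integers $j_1,\dots,j_{\ell+1}$ with $j_1+\cdots+j_{\ell+1}=n$, the number of $\ell$-multichains in $NC^{(k)}(B_n)$ with rank-jump vector $(j_1,\dots,j_{\ell+1})$ is $$\binom{n}{j_1}\binom{kn}{j_2}\binom{kn}{j_3}\cdots\binom{kn}{j_{\ell+1}}.$$ (2) For all $\ell\ge1$, the zeta polynomial of $NC^{(k)}(B_n)$ evaluated at $\ell$, that is, the number $\mathcal Z(NC^{(k)}(B_n),\ell)$ of $\ell$-multichains in $NC^{(k)}(B_n)$, is $\binom{(k\ell+1)n}{n}$. (3) For all $0\le i\le n$, the Fuss–Narayana number $\mathrm{Nar}^{(k)}(B_n,i)$, that is, the number of elements of $NC^{(k)}(B_n)$ of rank $i$, is $\binom{n}{i}\binom{kn}{n-i}$. -/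

import Mathlib

/-! ### Absolute order, Coxeter elements and noncrossing partitions

Here `W` is a group and `s : Fin n → W` is the family of its simple generators. -/

namespace FussB

section Absolute

variable {W : Type*} [Group W] {n : ℕ}

/-- The reflections: the closure under conjugation of the set of simple generators. -/
def reflections (s : Fin n → W) : Set W :=
  {t | ∃ (w : W) (i : Fin n), t = w * s i * w⁻¹}

/-- The absolute length: the least length of a word in the reflections whose product is `w`. -/
noncomputable def absLength (s : Fin n → W) (w : W) : ℕ :=
  sInf {r | ∃ L : List W, (∀ t ∈ L, t ∈ reflections s) ∧ L.length = r ∧ L.prod = w}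

/-- The absolute order: `u` is below `v` when `ℓ(v) = ℓ(u) + ℓ(u⁻¹ v)`. -/
def AbsLE (s : Fin n → W) (u v : W) : Prop :=
  absLength s v = absLength s u + absLength s (u⁻¹ * v)

/-- A Coxeter element: any conjugate of a product of all the simple generators, each taken once,
in some order. -/
def IsCoxeterElement (s : Fin n → W) (c : W) : Prop :=
  ∃ (σ : Equiv.Perm (Fin n)) (w : W), c = w * (List.ofFn fun i => s (σ i)).prod * w⁻¹

/-- The noncrossing partitions: the interval from the identity to `c` in the absolute order. -/
def NC (s : Fin n → W) (c : W) : Set W :=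
  {w | AbsLE s 1 w ∧ AbsLE s w c}

/-- The `k`-divisible noncrossing partitions: the multichains `π₁ ≤ π₂ ≤ ⋯ ≤ π_k` of noncrossing
partitions (the entry `π_{i+1}` is `π i`). -/
def NCk (s : Fin n → W) (c : W) (k : ℕ) : Type _ :=
  {π : Fin k → W // (∀ i, π i ∈ NC s c) ∧ ∀ i j : Fin k, (i : ℕ) + 1 = j → AbsLE s (π i) (π j)}

namespace NCk

variable {s : Fin n → W} {c : W} {k : ℕ}

/-- The entries of a multichain counted from `0`, continued by `c` beyond the last one. -/
def entry (π : NCk s c k) (i : ℕ) : W :=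
  if h : i < k then π.1 ⟨i, h⟩ else c

/-- The delta sequence `(π₁⁻¹ π₂, …, π_{k-1}⁻¹ π_k, π_k⁻¹ c)` of a multichain. -/
def delta (π : NCk s c k) (i : Fin k) : W :=
  (π.entry i)⁻¹ * π.entry (i + 1)

/-- The order on `k`-divisible noncrossing partitions: the dual of the componentwise absolute order
on delta sequences. -/
instance : LE (NCk s c k) where
  le π μ := ∀ i : Fin k, AbsLE s (μ.delta i) (π.delta i)

/-- The rank of a `k`-divisible noncrossing partition: the absolute length of its first entry. -/
noncomputable def rk (π : NCk s c k) : ℕ :=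
  absLength s (π.entry 0)

end NCk

/-- The `l`-multichains `P₁ ≤ P₂ ≤ ⋯ ≤ P_l` of elements of an ordered set. -/
def Multichain (X : Type*) [LE X] (l : ℕ) : Type _ :=
  {P : Fin l → X // ∀ i j : Fin l, (i : ℕ) + 1 = j → P i ≤ P j}

/-- The value at `l` of the zeta polynomial of an ordered set: the number of its `l`-multichains. -/
noncomputable def zeta (X : Type*) [LE X] (l : ℕ) : ℕ :=
  Nat.card (Multichain X l)

/-- The rank-jump vector `(r₁ - 0, r₂ - r₁, …, r_l - r_{l-1}, n - r_l)` of an `l`-multichain of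
`k`-divisible noncrossing partitions, where `r_i` is the rank of its `i`-th element and `n` is the
number of simple generators. -/
noncomputable def rankJump {s : Fin n → W} {c : W} {k l : ℕ}
    (P : Multichain (NCk s c k) l) (i : Fin (l + 1)) : ℤ :=
  let r : Fin (l + 2) → ℤ :=
    Fin.cons (α := fun _ => ℤ) 0 (Fin.snoc (α := fun _ => ℤ) (fun a => ((P.1 a).rk : ℤ)) (n : ℤ))
  r i.succ - r i.castSucc

/-- The Fuss–Narayana number: the number of `k`-divisible noncrossing partitions of rank `i`. -/
noncomputable def fussNarayana (s : Fin n → W) (c : W) (k i : ℕ) : ℕ :=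
  Nat.card {π : NCk s c k // π.rk = i}

end Absolute

/-! ### The group of signed permutations

The set `{1, …, n, -1, …, -n}` is `Fin n × ℤˣ`, the pair `(i, ε)` standing for `ε * (i + 1)`. -/

/-- The antipodal map `(1,-1)(2,-2)⋯(n,-n)`. -/
def antipodal (n : ℕ) : Equiv.Perm (Fin n × ℤˣ) :=
  Equiv.prodCongr (Equiv.refl (Fin n)) (Equiv.neg ℤˣ)

/-- The group `B_n` of signed permutations: the permutations commuting with the antipodal map. -/
abbrev B (n : ℕ) : Subgroup (Equiv.Perm (Fin n × ℤˣ)) :=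
  Subgroup.centralizer {antipodal n}

/-- The signed permutation `(i, j)(-i, -j)`. -/
def signedSwap {n : ℕ} (i j : Fin n) : B n :=
  ⟨Equiv.prodCongr (Equiv.swap i j) (Equiv.refl ℤˣ), by
    rw [Subgroup.mem_centralizer_singleton_iff]
    ext x <;> simp [antipodal]⟩

/-- The signed permutation `(i, -i)`. -/
def signChange {n : ℕ} (i : Fin n) : B n :=
  ⟨Equiv.swap (i, 1) (i, -1), by
    rw [Subgroup.mem_centralizer_singleton_iff, Equiv.mul_swap_eq_swap_mul]
    simp [antipodal, Equiv.swap_comm]⟩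

/-- The simple generators of `B_n`: `(i, i+1)(-i, -(i+1))` for `1 ≤ i < n`, and `(n, -n)`. -/
def simpleB (n : ℕ) (i : Fin n) : B n :=
  if h : (i : ℕ) + 1 < n then signedSwap i ⟨i + 1, h⟩ else signChange i

end FussB

/-!
The absolute length on `B n` is the codimension of the fixed space acting on odd functions, and
`∑ w, (t X) ^ ℓ(w) w` factors as `∏ j, (1 + t X J_j)` over commuting Jucys–Murphy elements `J_j`.
Successive quotients of delta sequences turn multichains into factorizations of `c` whose lengths
add up to `ℓ(c) = n`; these are counted by the coefficient of `X ^ n`, the lowest degree that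
occurs, at `c` in a product of such sums with various weights `t`, that is, in `∏ j, φ(X J_j)` with
`φ(x) = ∏ t, (1 + t x)`.

Evaluate this lowest-degree coefficient at products of cycles supported on disjoint intervals.
Multiplying by one more `J_j` can only split an interval or merge two, so the coefficients are
products over the intervals of coefficients of two power series: `A = z φ(A)` for a positive cycle
and `N = 1 + z φ'(A) N` for a negative one. For the Coxeter element, a single negative cycle,
Lagrange inversion yields `[z ^ n] N = [x ^ n] φ ^ n`, and `φ ^ n` expands into binomial
coefficients. The zeta polynomial then follows from Vandermonde's identity.
-/

namespace FussB

/-! ### Absolute length -/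

section AbsoluteLength

variable {W : Type*} [Group W] {n : ℕ} {s : Fin n → W}

theorem conj_mem_reflections {t : W} (g : W) (ht : t ∈ reflections s) :
    g * t * g⁻¹ ∈ reflections s := by
  obtain ⟨w, i, rfl⟩ := ht
  exact ⟨g * w, i, by group⟩

theorem absLength_prod_le_length {L : List W} (hL : ∀ t ∈ L, t ∈ reflections s) :
    absLength s L.prod ≤ L.length :=
  Nat.sInf_le ⟨L, hL, rfl, rfl⟩

@[simp]
theorem absLength_one : absLength s (1 : W) = 0 :=
  Nat.le_zero.1 (absLength_prod_le_length (L := []) (by simp))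

theorem absLength_conj (g w : W) : absLength s (g * w * g⁻¹) = absLength s w := by
  have conj_word : ∀ (g w : W) (r : ℕ),
      (∃ L : List W, (∀ t ∈ L, t ∈ reflections s) ∧ L.length = r ∧ L.prod = w) →
      ∃ L : List W, (∀ t ∈ L, t ∈ reflections s) ∧ L.length = r ∧ L.prod = g * w * g⁻¹ := by
    rintro g _ _ ⟨L, hL, rfl, rfl⟩
    refine ⟨L.map (MulAut.conj g), ?_, L.length_map _, (map_list_prod (MulAut.conj g) L).symm⟩
    exact List.forall_mem_map.2 fun t ht => conj_mem_reflections g (hL t ht)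
  refine congrArg sInf (Set.ext fun r => ⟨fun h => ?_, conj_word g w r⟩)
  have := conj_word g⁻¹ _ r h
  rwa [show g⁻¹ * (g * w * g⁻¹) * g⁻¹⁻¹ = w by group] at this

theorem absLength_mul_comm (u v : W) : absLength s (u * v) = absLength s (v * u) := by
  rw [← absLength_conj v (u * v)]
  congr 1
  group

variable (hs : Submonoid.closure (reflections s) = ⊤)
include hs

theorem exists_reflection_word (w : W) :
    ∃ L : List W, (∀ t ∈ L, t ∈ reflections s) ∧ L.length = absLength s w ∧ L.prod = w := by
  have hw : w ∈ Submonoid.closure (reflections s) := hs ▸ Submonoid.mem_top w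
  obtain ⟨L, hL, hLw⟩ := Submonoid.exists_list_of_mem_closure hw
  exact Nat.sInf_mem (s := {r | ∃ L : List W, (∀ t ∈ L, t ∈ reflections s) ∧
    L.length = r ∧ L.prod = w}) ⟨_, L, hL, rfl, hLw⟩

theorem absLength_mul_le (u v : W) : absLength s (u * v) ≤ absLength s u + absLength s v := by
  obtain ⟨L, hL, hLu, rfl⟩ := exists_reflection_word hs u
  obtain ⟨M, hM, hMv, rfl⟩ := exists_reflection_word hs v
  rw [← hLu, ← hMv, ← List.length_append, ← List.prod_append]
  exact absLength_prod_le_length fun t ht => (List.mem_append.1 ht).elim (hL t) (hM t)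

theorem absLength_prod_ofFn_le {k : ℕ} (v : Fin k → W) :
    absLength s (List.ofFn v).prod ≤ ∑ i, absLength s (v i) := by
  induction k with
  | zero => simp
  | succ k ih =>
    rw [List.ofFn_succ, List.prod_cons, Fin.sum_univ_succ]
    exact (absLength_mul_le hs _ _).trans (Nat.add_le_add_left (ih _) _)

theorem absLength_prod_mul_inv_prod_le {k : ℕ} (u v : Fin k → W) :
    absLength s ((List.ofFn u).prod * (List.ofFn v).prod⁻¹) ≤
      ∑ i, absLength s (u i * (v i)⁻¹) := by
  induction k with
  | zero => simp
  | succ k ih =>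
    rw [List.ofFn_succ, List.prod_cons, List.ofFn_succ, List.prod_cons, Fin.sum_univ_succ]
    set U := (List.ofFn fun i : Fin k => u i.succ).prod
    set V := (List.ofFn fun i : Fin k => v i.succ).prod
    have split_head : u 0 * U * (v 0 * V)⁻¹ =
        u 0 * (v 0)⁻¹ * (v 0 * (U * V⁻¹) * (v 0)⁻¹) := by group
    rw [split_head]
    refine (absLength_mul_le hs _ _).trans ?_
    rw [absLength_conj]
    exact Nat.add_le_add_left (ih _ _) _

end AbsoluteLength

/-! ### Successive quotients of a sequence -/

section Ratio

variable {G : Type*} {m : ℕ}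

/-- The entries of a sequence counted from `0`, continued by `z` beyond the last one. -/
def extend (z : G) (x : Fin m → G) (i : ℕ) : G := if h : i < m then x ⟨i, h⟩ else z

theorem extend_coe (z : G) (x : Fin m → G) (i : Fin m) : extend z x i = x i := dif_pos i.2

theorem extend_of_le (z : G) (x : Fin m → G) {i : ℕ} (h : m ≤ i) : extend z x i = z :=
  dif_neg (not_lt.2 h)

variable [Group G]

/-- The successive quotients `(x₀⁻¹ x₁, …, x_{m-1}⁻¹ z)` of a sequence continued by `z`. They are
used both for the entries of an element of `NCk` and for the delta sequences of a multichain. -/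
def ratio (z : G) (x : Fin m → G) (i : Fin m) : G := (extend z x i)⁻¹ * extend z x (i + 1)

theorem ratio_injective (z : G) : Function.Injective (ratio (m := m) z) := by
  intro x y h
  have extend_eq : ∀ i ≤ m, extend z x i = extend z y i := fun i hi => by
    induction hi using Nat.decreasingInduction with
    | self => rw [extend_of_le z x le_rfl, extend_of_le z y le_rfl]
    | of_succ i hi ih =>
      have h_i := congrFun h ⟨i, hi⟩
      rw [ratio, ratio, ih] at h_i
      exact inv_injective (mul_right_cancel h_i)
  funext i
  rw [← extend_coe z x, ← extend_coe z y, extend_eq i i.2.le]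

theorem ratio_surjective (z : G) : Function.Surjective (ratio (m := m) z) := by
  intro δ
  let tail (i : ℕ) : G := ((List.ofFn δ).drop i).prod
  have extend_eq (i : ℕ) : extend z (fun i : Fin m => z * (tail i)⁻¹) i = z * (tail i)⁻¹ := by
    rcases lt_or_ge i m with hi | hi
    · exact extend_coe z _ ⟨i, hi⟩
    · simp [extend_of_le, hi, tail, List.drop_eq_nil_of_le]
  refine ⟨fun i => z * (tail i)⁻¹, funext fun i => ?_⟩
  have tail_eq : tail i = δ i * tail (i + 1) := by
    simp only [tail]
    rw [List.drop_eq_getElem_cons (by simp), List.prod_cons, List.getElem_ofFn]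
  rw [ratio, extend_eq, extend_eq, tail_eq]
  group

theorem prod_ofFn_inv_mul_succ (y : ℕ → G) (m : ℕ) :
    (List.ofFn fun i : Fin m => (y i)⁻¹ * y (i + 1)).prod = (y 0)⁻¹ * y m := by
  induction m with
  | zero => simp
  | succ m ih =>
    rw [List.ofFn_succ', List.concat_eq_append, List.prod_append, List.prod_singleton]
    simp only [Fin.val_castSucc, Fin.val_last, ih]
    group

theorem prod_ofFn_ratio (z : G) (x : Fin m → G) :
    (List.ofFn (ratio z x)).prod = (extend z x 0)⁻¹ * z := by
  have := prod_ofFn_inv_mul_succ (extend z x) m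
  rwa [extend_of_le z x le_rfl] at this

theorem prod_ofFn_apply {M : Type*} [Monoid M] {k : ℕ} (F : Fin m → Fin k → M) (i : Fin k) :
    (List.ofFn F).prod i = (List.ofFn fun a => F a i).prod := by
  have := map_list_prod (Pi.evalMonoidHom (fun _ : Fin k => M) i) (List.ofFn F)
  rwa [List.map_ofFn] at this

end Ratio

/-- Here `r a` and `A a` are the distances from the `a`-th vertex of a path with steps `f` to its
start and to its end. -/
theorem eq_of_triangle_le {A r f : ℕ → ℕ} {l N : ℕ} (hA : ∀ a < l, A a ≤ f a + A (a + 1))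
    (hl : A l = 0) (hr : ∀ a < l, r (a + 1) ≤ r a + f a) (hN : ∀ a ≤ l, N ≤ r a + A a)
    (h0 : r 0 + ∑ a ∈ Finset.range l, f a = N) :
    (∀ a ≤ l, r a + A a = N) ∧ ∀ a < l, A a = f a + A (a + 1) ∧ r (a + 1) = r a + f a := by
  have r_le : ∀ a ≤ l, r a + ∑ b ∈ Finset.Ico a l, f b ≤ N := fun a => by
    induction a with
    | zero => intro _; rw [← Finset.range_eq_Ico, h0]
    | succ a ih =>
      intro ha
      have := ih (by omega)
      rw [Finset.sum_eq_sum_Ico_succ_bot ha] at this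
      have := hr a ha
      omega
  have A_le : ∀ a ≤ l, A a ≤ ∑ b ∈ Finset.Ico a l, f b := fun a ha => by
    induction ha using Nat.decreasingInduction with
    | self => simp [hl]
    | of_succ a ha ih =>
      rw [Finset.sum_eq_sum_Ico_succ_bot ha]
      exact (hA a ha).trans (Nat.add_le_add_left ih _)
  have eqs : ∀ a ≤ l, r a + A a = N ∧ A a = ∑ b ∈ Finset.Ico a l, f b := fun a ha => by
    have := r_le a ha
    have := A_le a ha
    have := hN a ha
    omega
  refine ⟨fun a ha => (eqs a ha).1, fun a ha => ?_⟩
  have := eqs a ha.le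
  have := eqs (a + 1) ha
  have := Finset.sum_eq_sum_Ico_succ_bot ha f
  omega

/-! ### Multichains as factorizations -/

section Factorizations

variable {W : Type*} [Group W] {n : ℕ} {s : Fin n → W} {c : W} {k l : ℕ}

namespace NCk

theorem entry_coe (π : NCk s c k) (i : Fin k) : π.entry i = π.1 i := extend_coe c π.1 i

theorem entry_last (π : NCk s c k) : π.entry k = c := extend_of_le c π.1 le_rfl

theorem delta_injective : Function.Injective (delta : NCk s c k → Fin k → W) := fun _ _ h =>
  Subtype.ext (ratio_injective c h)

theorem absLE_entry_succ (π : NCk s c k) (i : Fin k) :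
    AbsLE s (π.entry i) (π.entry (i + 1)) := by
  rw [entry_coe]
  rcases Nat.lt_or_eq_of_le i.2 with h | h
  · exact π.entry_coe ⟨i + 1, h⟩ ▸ π.2.2 i ⟨i + 1, h⟩ rfl
  · rw [show (i : ℕ) + 1 = k from h, entry_last]
    exact (π.2.1 i).2

theorem rk_add_sum_delta (π : NCk s c k) :
    π.rk + ∑ i, absLength s (π.delta i) = absLength s c := by
  have partial_sum : ∀ m ≤ k, absLength s (π.entry 0) +
      ∑ i ∈ Finset.range m, absLength s ((π.entry i)⁻¹ * π.entry (i + 1)) =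
        absLength s (π.entry m) := fun m => by
    induction m with
    | zero => intro _; simp
    | succ m ih =>
      intro hm
      rw [Finset.sum_range_succ, ← add_assoc, ih (by omega)]
      exact (π.absLE_entry_succ ⟨m, hm⟩).symm
  have total := partial_sum k le_rfl
  rwa [entry_last, Finset.sum_range] at total

theorem rk_eq (π : NCk s c k) : π.rk = absLength s (c * (List.ofFn π.delta).prod⁻¹) := by
  have prod_delta : (List.ofFn π.delta).prod = (π.entry 0)⁻¹ * c := prod_ofFn_ratio c π.1
  rw [rk, prod_delta]
  congr 1
  group

theorem exists_delta_eq (hs : Submonoid.closure (reflections s) = ⊤) {δ : Fin k → W}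
    (h : absLength s (c * (List.ofFn δ).prod⁻¹) + ∑ i, absLength s (δ i) = absLength s c) :
    ∃ π : NCk s c k, π.delta = δ := by
  obtain ⟨y, rfl⟩ := ratio_surjective c δ
  have triangle : ∀ u v w : W, absLength s (u⁻¹ * w) ≤
      absLength s (u⁻¹ * v) + absLength s (v⁻¹ * w) := fun u v w => by
    refine le_of_eq_of_le ?_ (absLength_mul_le hs _ _)
    congr 1
    group
  have head_eq : c * (List.ofFn (ratio c y)).prod⁻¹ = extend c y 0 := by
    rw [prod_ofFn_ratio]
    group
  obtain ⟨le_c, steps⟩ := eq_of_triangle_le (A := fun m => absLength s ((extend c y m)⁻¹ * c))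
    (r := fun m => absLength s (extend c y m))
    (f := fun m => absLength s ((extend c y m)⁻¹ * extend c y (m + 1))) (l := k)
    (fun a _ => triangle _ _ _)
    (by simp [extend_of_le])
    (fun a _ => by simpa using triangle 1 (extend c y a) (extend c y (a + 1)))
    (fun a _ => by simpa using triangle 1 (extend c y a) c)
    (by rw [Finset.sum_range, ← head_eq]; exact h)
  refine ⟨⟨y, fun i => ⟨by simp [AbsLE], ?_⟩, fun i j hij => ?_⟩, rfl⟩
  · rw [AbsLE, ← le_c i i.2.le, extend_coe]
  · have step := (steps i i.2).2
    simp only [hij, extend_coe] at step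
    exact step

end NCk

/-- For a matrix `F` of group elements whose columns have products `p₁, …, p_k`, the absolute
length of the `g` with `g p₁ ⋯ p_k = c`, followed by the total absolute lengths of the rows. -/
noncomputable def factorLengths (s : Fin n → W) (c : W) (F : Fin l → Fin k → W) :
    Fin (l + 1) → ℕ :=
  Fin.cons (absLength s (c * (List.ofFn fun i => (List.ofFn fun a => F a i).prod).prod⁻¹))
    fun a => ∑ i, absLength s (F a i)

theorem eq_of_sum_quotients_eq (hs : Submonoid.closure (reflections s) = ⊤)
    {e : ℕ → Fin k → W} (he : e l = 1)
    (h : absLength s (c * (List.ofFn (e 0)).prod⁻¹) +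
      ∑ a ∈ Finset.range l, ∑ i, absLength s (e a i * (e (a + 1) i)⁻¹) = absLength s c) :
    (∀ a ≤ l, absLength s (c * (List.ofFn (e a)).prod⁻¹) + ∑ i, absLength s (e a i) =
      absLength s c) ∧
    ∀ a < l, ∀ i, absLength s (e a i) =
      absLength s (e a i * (e (a + 1) i)⁻¹) + absLength s (e (a + 1) i) := by
  have step_le : ∀ a i, absLength s (e a i) ≤
      absLength s (e a i * (e (a + 1) i)⁻¹) + absLength s (e (a + 1) i) := fun a i => by
    simpa using absLength_mul_le hs (e a i * (e (a + 1) i)⁻¹) (e (a + 1) i)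
  have triangle : ∀ u v : W, absLength s (c * v⁻¹) ≤
      absLength s (c * u⁻¹) + absLength s (u * v⁻¹) := fun u v => by
    simpa using absLength_mul_le hs (c * u⁻¹) (u * v⁻¹)
  obtain ⟨total, steps⟩ := eq_of_triangle_le (A := fun a => ∑ i, absLength s (e a i))
    (r := fun a => absLength s (c * (List.ofFn (e a)).prod⁻¹))
    (f := fun a => ∑ i, absLength s (e a i * (e (a + 1) i)⁻¹)) (N := absLength s c)
    (fun a _ => by
      rw [← Finset.sum_add_distrib]
      exact Finset.sum_le_sum fun i _ => step_le a i)
    (by simp [he])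
    (fun a _ => (triangle _ _).trans
      (Nat.add_le_add_left (absLength_prod_mul_inv_prod_le hs _ _) _))
    (fun a _ => by
      refine le_trans ?_ (Nat.add_le_add_left (absLength_prod_ofFn_le hs _) _)
      simpa using absLength_mul_le hs (c * (List.ofFn (e a)).prod⁻¹) (List.ofFn (e a)).prod)
    h
  refine ⟨total, fun a ha i => ?_⟩
  have step := (steps a ha).1
  simp only [← Finset.sum_add_distrib] at step
  exact (Finset.sum_eq_sum_iff_of_le fun i _ => step_le a i).1 step i (Finset.mem_univ i)

namespace Multichain

/-- The delta sequences of a multichain, continued by `1`. -/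
noncomputable def deltas (P : Multichain (NCk s c k) l) (a : ℕ) : Fin k → W :=
  extend 1 (fun a => (P.1 a).delta) a

/-- The componentwise quotients of consecutive delta sequences of a multichain. The order on
`NCk` reverses the absolute order on delta sequences, hence the inverses. -/
noncomputable def factors (P : Multichain (NCk s c k) l) : Fin l → Fin k → W :=
  ratio 1 fun a => ((P.1 a).delta)⁻¹

theorem deltas_coe (P : Multichain (NCk s c k) l) (a : Fin l) :
    P.deltas a = (P.1 a).delta :=
  extend_coe _ _ a

theorem deltas_last (P : Multichain (NCk s c k) l) : P.deltas l = 1 := extend_of_le _ _ le_rfl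

theorem factors_injective :
    Function.Injective (factors : Multichain (NCk s c k) l → Fin l → Fin k → W) :=
  fun _ _ h => Subtype.ext <| funext fun a =>
    NCk.delta_injective (inv_injective (congrFun (ratio_injective 1 h) a))

theorem extend_inv_delta (P : Multichain (NCk s c k) l) (a : ℕ) :
    extend 1 (fun a => ((P.1 a).delta)⁻¹) a = (P.deltas a)⁻¹ := by
  unfold deltas extend
  split_ifs
  · rfl
  · rw [inv_one]

theorem factors_apply (P : Multichain (NCk s c k) l) (a : Fin l) (i : Fin k) :
    P.factors a i = P.deltas a i * (P.deltas (a + 1) i)⁻¹ := by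
  rw [factors, ratio, extend_inv_delta, extend_inv_delta, inv_inv]
  rfl

theorem prod_factors (P : Multichain (NCk s c k) l) (i : Fin k) :
    (List.ofFn fun a => P.factors a i).prod = P.deltas 0 i := by
  rw [← prod_ofFn_apply, factors, prod_ofFn_ratio, extend_inv_delta, inv_inv, mul_one]

theorem absLength_deltas (P : Multichain (NCk s c k) l) (a : Fin l) (i : Fin k) :
    absLength s (P.deltas a i) =
      absLength s (P.factors a i) + absLength s (P.deltas (a + 1) i) := by
  rw [factors_apply, deltas_coe]
  rcases Nat.lt_or_eq_of_le a.2 with h | h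
  · have le_delta := P.2 a ⟨a + 1, h⟩ rfl i
    rw [show P.deltas (a + 1) = _ from P.deltas_coe ⟨a + 1, h⟩, le_delta, add_comm,
      absLength_mul_comm]
  · simp [show (a : ℕ) + 1 = l from h, deltas_last]

theorem absLength_add_sum_deltas (P : Multichain (NCk s c k) l) (m : Fin (l + 1)) :
    absLength s (c * (List.ofFn (P.deltas m)).prod⁻¹) + ∑ i, absLength s (P.deltas m i) =
      absLength s c := by
  induction m using Fin.lastCases with
  | last => simp [deltas_last, Pi.one_def]
  | cast a => rw [Fin.val_castSucc, deltas_coe, ← NCk.rk_eq, NCk.rk_add_sum_delta]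

theorem snoc_rk_eq (hc : absLength s c = n) (P : Multichain (NCk s c k) l) (m : Fin (l + 1)) :
    (Fin.snoc (fun a => ((P.1 a).rk : ℤ)) (n : ℤ) : Fin (l + 1) → ℤ) m =
      absLength s (c * (List.ofFn (P.deltas m)).prod⁻¹) := by
  induction m using Fin.lastCases with
  | last => simp [deltas_last, Pi.one_def, hc]
  | cast a => rw [Fin.snoc_castSucc, Fin.val_castSucc, deltas_coe, NCk.rk_eq]

theorem rankJump_eq (hc : absLength s c = n) (P : Multichain (NCk s c k) l) (i : Fin (l + 1)) :
    rankJump P i = factorLengths s c P.factors i := by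
  induction i using Fin.cases with
  | zero =>
    simp only [rankJump, Fin.cons_succ, snoc_rk_eq hc, Fin.castSucc_zero, Fin.cons_zero,
      sub_zero, factorLengths, prod_factors]
    rfl
  | succ a =>
    have row_sum : ∑ i, absLength s (P.deltas a i) =
        ∑ i, absLength s (P.factors a i) + ∑ i, absLength s (P.deltas (a + 1) i) := by
      rw [← Finset.sum_add_distrib]
      exact Finset.sum_congr rfl fun i _ => P.absLength_deltas a i
    have total := P.absLength_add_sum_deltas a.castSucc
    have total_succ := P.absLength_add_sum_deltas a.succ
    simp only [rankJump, Fin.cons_succ, ← Fin.succ_castSucc, snoc_rk_eq hc, factorLengths]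
    simp only [Fin.val_castSucc, Fin.val_succ] at total total_succ ⊢
    omega

theorem sum_rankJump (P : Multichain (NCk s c k) l) : ∑ i, rankJump P i = n := by
  simp only [rankJump, Finset.sum_sub_distrib]
  set r : Fin (l + 2) → ℤ :=
    Fin.cons 0 (Fin.snoc (α := fun _ => ℤ) (fun a => ((P.1 a).rk : ℤ)) (n : ℤ)) with hr
  have r_zero : r 0 = 0 := rfl
  have r_last : r (Fin.last (l + 1)) = n := by
    rw [hr, ← Fin.succ_last, Fin.cons_succ, Fin.snoc_last]
  linarith [Fin.sum_univ_succ r, Fin.sum_univ_castSucc r]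

theorem exists_factors_eq (hs : Submonoid.closure (reflections s) = ⊤)
    {F : Fin l → Fin k → W} (hF : ∑ i, factorLengths s c F i = absLength s c) :
    ∃ P : Multichain (NCk s c k) l, P.factors = F := by
  obtain ⟨x, rfl⟩ := ratio_surjective (1 : Fin k → W) F
  set e : ℕ → Fin k → W := fun a => (extend 1 x a)⁻¹ with he
  have ratio_apply : ∀ a : Fin l, ratio 1 x a = e a * (e (a + 1))⁻¹ := fun a => by
    simp only [he, inv_inv, ratio]
  have column_prod : ∀ i, (List.ofFn fun a => ratio 1 x a i).prod = e 0 i := fun i => by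
    rw [← prod_ofFn_apply, prod_ofFn_ratio, mul_one]
  obtain ⟨total, steps⟩ := eq_of_sum_quotients_eq hs (e := e) (l := l) (c := c)
    (by simp [he, extend_of_le]) (by
      rw [← hF, Fin.sum_univ_succ, Finset.sum_range]
      simp only [factorLengths, Fin.cons_zero, Fin.cons_succ, column_prod]
      simp only [ratio_apply, Pi.mul_apply, Pi.inv_apply])
  choose π hπ using fun a : Fin l => NCk.exists_delta_eq hs (total a a.2.le)
  refine ⟨⟨π, fun a b hab i => ?_⟩, congrArg (ratio 1) (funext fun a => ?_)⟩
  · rw [AbsLE, hπ, hπ, ← hab, steps a a.2, add_comm, absLength_mul_comm]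
  · rw [hπ, he, inv_inv, extend_coe]

theorem card_rankJump_eq_card_factorLengths (hs : Submonoid.closure (reflections s) = ⊤)
    (hc : absLength s c = n) {j : Fin (l + 1) → ℕ} (hj : ∑ i, j i = n) :
    Nat.card {P : Multichain (NCk s c k) l // ∀ i, rankJump P i = j i} =
      Nat.card {F : Fin l → Fin k → W // factorLengths s c F = j} := by
  have rankJump_iff : ∀ P : Multichain (NCk s c k) l,
      (∀ i, rankJump P i = j i) ↔ factorLengths s c P.factors = j := fun P => by
    simp only [rankJump_eq hc, Nat.cast_inj, funext_iff]
  refine Nat.card_congr (Equiv.ofBijective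
    (fun P => ⟨P.1.factors, (rankJump_iff P.1).1 P.2⟩) ⟨fun P Q h => ?_, fun F => ?_⟩)
  · exact Subtype.ext (factors_injective (congrArg Subtype.val h))
  · obtain ⟨P, hP⟩ := exists_factors_eq hs (F := F.1) (by rw [F.2, hj, hc])
    exact ⟨⟨P, (rankJump_iff P).2 (hP ▸ F.2)⟩, Subtype.ext hP⟩

end Multichain

theorem zeta_eq_sum_card_rankJump [Finite W] (hc : absLength s c = n) :
    zeta (NCk s c k) l = ∑ j ∈ Finset.univ.finsuppAntidiag n,
      Nat.card {P : Multichain (NCk s c k) l // ∀ i, rankJump P i = (j i : ℤ)} := by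
  classical
  have : Finite (Multichain (NCk s c k) l) := Finite.of_injective _ Multichain.factors_injective
  have := Fintype.ofFinite (Multichain (NCk s c k) l)
  let v (P : Multichain (NCk s c k) l) : Fin (l + 1) →₀ ℕ :=
    Finsupp.equivFunOnFinite.symm (factorLengths s c P.factors)
  have rankJump_eq_v (P : Multichain (NCk s c k) l) (i : Fin (l + 1)) : rankJump P i = v P i :=
    P.rankJump_eq hc i
  have v_mem (P : Multichain (NCk s c k) l) : v P ∈ Finset.univ.finsuppAntidiag n := by
    have sum_eq := P.sum_rankJump
    simp only [rankJump_eq_v] at sum_eq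
    exact Finset.mem_finsuppAntidiag.2 ⟨by exact_mod_cast sum_eq, Finset.subset_univ _⟩
  rw [zeta, Nat.card_eq_fintype_card, ← Finset.card_univ,
    Finset.card_eq_sum_card_fiberwise fun P _ => v_mem P]
  refine Finset.sum_congr rfl fun j _ => ?_
  rw [← Fintype.card_subtype, ← Nat.card_eq_fintype_card]
  exact Nat.card_congr (Equiv.subtypeEquivRight fun P => by
    simp only [rankJump_eq_v, Nat.cast_inj, DFunLike.ext_iff])

end Factorizations

/-! ### Signed permutations -/

section SignedPermutations

variable {n : ℕ}

/-- The opposite of a signed index. -/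
def bar (x : Fin n × ℤˣ) : Fin n × ℤˣ := (x.1, -x.2)

@[simp] theorem bar_bar (x : Fin n × ℤˣ) : bar (bar x) = x := by simp [bar]

@[simp] theorem bar_fst (x : Fin n × ℤˣ) : (bar x).1 = x.1 := rfl

@[simp] theorem bar_snd (x : Fin n × ℤˣ) : (bar x).2 = -x.2 := rfl

theorem bar_ne (x : Fin n × ℤˣ) : bar x ≠ x := fun h =>
  units_ne_neg_self x.2 (congrArg Prod.snd h).symm

theorem bar_eq_iff {x y : Fin n × ℤˣ} : bar x = y ↔ x = bar y :=
  ⟨fun h => by rw [← h, bar_bar], fun h => by rw [h, bar_bar]⟩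

@[simp] theorem bar_inj {x y : Fin n × ℤˣ} : bar x = bar y ↔ x = y := by
  rw [bar_eq_iff, bar_bar]

theorem eq_or_eq_bar_of_fst_eq {x y : Fin n × ℤˣ} (h : x.1 = y.1) : x = y ∨ x = bar y := by
  obtain ⟨i, ε⟩ := x
  obtain ⟨j, δ⟩ := y
  obtain rfl : i = j := h
  rcases Int.units_eq_one_or ε with rfl | rfl <;> rcases Int.units_eq_one_or δ with rfl | rfl <;>
    simp [bar]

theorem antipodal_apply (x : Fin n × ℤˣ) : antipodal n x = bar x := rfl

theorem mem_B_iff {w : Equiv.Perm (Fin n × ℤˣ)} : w ∈ B n ↔ ∀ x, w (bar x) = bar (w x) := by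
  rw [Subgroup.mem_centralizer_singleton_iff, Equiv.ext_iff]
  exact forall_congr' fun x => by simp [antipodal_apply]

@[simp] theorem apply_bar (w : B n) (x : Fin n × ℤˣ) : w.1 (bar x) = bar (w.1 x) :=
  mem_B_iff.1 w.2 x

theorem B_ext {u v : B n} (h : ∀ x, u.1 x = v.1 x) : u = v := Subtype.ext (Equiv.ext h)

theorem mul_apply (u v : B n) (x : Fin n × ℤˣ) : (u * v).1 x = u.1 (v.1 x) := rfl

@[simp] theorem inv_apply_self (u : B n) (x : Fin n × ℤˣ) : (u⁻¹).1 (u.1 x) = x :=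
  Equiv.symm_apply_apply u.1 x

@[simp] theorem apply_inv_self (u : B n) (x : Fin n × ℤˣ) : u.1 ((u⁻¹).1 x) = x :=
  Equiv.apply_symm_apply u.1 x

/-- The map underlying the reflection exchanging `a` with `b` and `-a` with `-b`. -/
def reflectionFun (a b x : Fin n × ℤˣ) : Fin n × ℤˣ :=
  if x = a then b else if x = b then a else if x = bar a then bar b else
    if x = bar b then bar a else x

theorem reflectionFun_involutive (a b : Fin n × ℤˣ) : Function.Involutive (reflectionFun a b) := by
  intro x
  have := bar_ne a
  have := bar_ne b
  have := bar_bar a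
  have := bar_bar b
  unfold reflectionFun
  grind

/-- The signed permutation `(a, b)(-a, -b)`; it is the identity if `a = b`, and `(a, -a)` if
`b = -a`. -/
def reflection (a b : Fin n × ℤˣ) : B n :=
  ⟨(reflectionFun_involutive a b).toPerm, by
    rw [mem_B_iff]
    intro x
    have := bar_ne a
    have := bar_ne b
    simp only [Function.Involutive.coe_toPerm, reflectionFun, bar_eq_iff, bar_bar]
    split_ifs <;> simp_all [bar_eq_iff]⟩

theorem reflection_apply (a b x : Fin n × ℤˣ) : (reflection a b).1 x = reflectionFun a b x := rfl

@[simp] theorem reflection_reflection_apply (a b x : Fin n × ℤˣ) :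
    (reflection a b).1 ((reflection a b).1 x) = x :=
  reflectionFun_involutive a b x

@[simp] theorem reflection_left (a b : Fin n × ℤˣ) : (reflection a b).1 a = b := by
  simp [reflection_apply, reflectionFun]

@[simp] theorem reflection_right (a b : Fin n × ℤˣ) : (reflection a b).1 b = a := by
  simp +contextual [reflection_apply, reflectionFun]

theorem reflection_of_ne {a b x : Fin n × ℤˣ} (ha : x.1 ≠ a.1) (hb : x.1 ≠ b.1) :
    (reflection a b).1 x = x := by
  rw [reflection_apply, reflectionFun, if_neg, if_neg, if_neg, if_neg] <;> rintro rfl <;>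
    simp at ha hb

@[simp] theorem reflection_mul_self (a b : Fin n × ℤˣ) : reflection a b * reflection a b = 1 :=
  B_ext (reflectionFun_involutive a b)

@[simp] theorem reflection_inv (a b : Fin n × ℤˣ) : (reflection a b)⁻¹ = reflection a b :=
  inv_eq_of_mul_eq_one_left (reflection_mul_self a b)

@[simp] theorem reflection_self (a : Fin n × ℤˣ) : reflection a a = 1 := by
  refine B_ext fun x => ?_
  rw [reflection_apply, reflectionFun]
  split_ifs <;> simp_all

theorem reflection_comm (a b : Fin n × ℤˣ) : reflection a b = reflection b a := by
  refine B_ext fun x => ?_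
  simp only [reflection_apply, reflectionFun]
  split_ifs <;> simp_all

theorem reflection_bar_bar (a b : Fin n × ℤˣ) : reflection (bar a) (bar b) = reflection a b := by
  refine B_ext fun x => ?_
  have := bar_ne a
  have := bar_ne b
  simp only [reflection_apply, reflectionFun, bar_bar]
  split_ifs <;> simp_all [bar_eq_iff]

theorem mul_reflection (w : B n) (a b : Fin n × ℤˣ) :
    w * reflection a b = reflection (w.1 a) (w.1 b) * w := by
  refine B_ext fun x => ?_
  simp only [mul_apply, reflection_apply, reflectionFun, ← apply_bar, w.1.injective.eq_iff]
  split_ifs <;> rfl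

theorem conj_reflection (w : B n) (a b : Fin n × ℤˣ) :
    w * reflection a b * w⁻¹ = reflection (w.1 a) (w.1 b) := by
  rw [mul_reflection, mul_inv_cancel_right]

theorem commute_reflection_reflection {a b c d : Fin n × ℤˣ} (hac : a.1 ≠ c.1) (had : a.1 ≠ d.1)
    (hbc : b.1 ≠ c.1) (hbd : b.1 ≠ d.1) : Commute (reflection a b) (reflection c d) := by
  rw [Commute, SemiconjBy, mul_reflection, reflection_of_ne hac.symm hbc.symm,
    reflection_of_ne had.symm hbd.symm]

/-! ### The simple generators and the reflections -/

theorem signedSwap_eq (i j : Fin n) : signedSwap i j = reflection (i, 1) (j, 1) := by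
  refine B_ext fun ⟨x, ε⟩ => ?_
  simp only [signedSwap, reflection_apply, reflectionFun, bar, Prod.mk.injEq, Equiv.prodCongr_apply,
    Prod.map, Equiv.refl_apply, Equiv.swap_apply_def]
  rcases Int.units_eq_one_or ε with rfl | rfl <;> grind

theorem signChange_eq (i : Fin n) : signChange i = reflection (i, 1) (i, -1) := by
  refine B_ext fun ⟨x, ε⟩ => ?_
  simp only [signChange, reflection_apply, reflectionFun, bar, Prod.mk.injEq, Equiv.swap_apply_def]
  rcases Int.units_eq_one_or ε with rfl | rfl <;> grind

theorem exists_map_eq {i j : Fin n} (hij : i ≠ j) {a b : Fin n × ℤˣ} (hab : a.1 ≠ b.1) :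
    ∃ w : B n, w.1 (i, 1) = a ∧ w.1 (j, 1) = b := by
  set b' := (reflection (i, 1) a).1 b with hb'
  have apply_b' : (reflection (i, 1) a).1 b' = b := by
    rw [hb', ← mul_apply, reflection_mul_self]
    rfl
  have h : i ≠ b'.1 := fun h => hab <| by
    rw [← apply_b']
    rcases eq_or_eq_bar_of_fst_eq (x := b') (y := (i, 1)) h.symm with h | h
    · rw [h, reflection_left]
    · rw [h, apply_bar, reflection_left, bar_fst]
  refine ⟨reflection (i, 1) a * reflection (j, 1) b', ?_, ?_⟩
  · rw [mul_apply, reflection_of_ne (x := (i, 1)) hij h, reflection_left]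
  · rw [mul_apply, reflection_left, apply_b']

theorem reflection_mem_reflections {a b : Fin n × ℤˣ} (h : a ≠ b) :
    reflection a b ∈ reflections (simpleB n) := by
  have hn : 0 < n := a.1.pos
  by_cases hab : a.1 = b.1
  · obtain rfl : b = bar a := (eq_or_eq_bar_of_fst_eq hab.symm).resolve_left h.symm
    refine ⟨reflection (⟨n - 1, by omega⟩, 1) a, ⟨n - 1, by omega⟩, ?_⟩
    rw [simpleB, dif_neg (by simp; omega), signChange_eq, conj_reflection, reflection_left]
    congr
    rw [show ((⟨n - 1, by omega⟩, -1) : Fin n × ℤˣ) = bar (⟨n - 1, by omega⟩, 1) from rfl,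
      apply_bar, reflection_left]
  · have one_lt : 1 < n := by
      have := a.1.2
      have := b.1.2
      have : a.1.1 ≠ b.1.1 := fun h => hab (Fin.ext h)
      omega
    obtain ⟨w, hwa, hwb⟩ := exists_map_eq (i := ⟨0, hn⟩) (j := ⟨0 + 1, one_lt⟩) (by simp) hab
    refine ⟨w, ⟨0, hn⟩, ?_⟩
    rw [simpleB, dif_pos (by simpa using one_lt), signedSwap_eq, conj_reflection, hwa, hwb]

theorem exists_eq_reflection {t : B n} (ht : t ∈ reflections (simpleB n)) :
    ∃ a b, a ≠ b ∧ t = reflection a b := by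
  obtain ⟨w, i, rfl⟩ := ht
  rw [simpleB]
  split_ifs with h
  · rw [signedSwap_eq, conj_reflection]
    exact ⟨_, _, by simp [Fin.ext_iff], rfl⟩
  · rw [signChange_eq, conj_reflection]
    exact ⟨_, _, by simp, rfl⟩

/-! ### Signed permutations fixing the last indices -/

/-- The property of fixing all signed indices of absolute value at least `j`. -/
def Fixes (j : ℕ) (w : B n) : Prop := ∀ x : Fin n × ℤˣ, j ≤ x.1 → w.1 x = x

theorem Fixes.mono {i j : ℕ} {w : B n} (h : Fixes i w) (hij : i ≤ j) : Fixes j w :=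
  fun x hx => h x (hij.trans hx)

theorem fixes_one (j : ℕ) : Fixes j (1 : B n) := fun _ _ => rfl

theorem Fixes.mul {j : ℕ} {u v : B n} (hu : Fixes j u) (hv : Fixes j v) : Fixes j (u * v) :=
  fun x hx => by rw [mul_apply, hv x hx, hu x hx]

theorem Fixes.inv {j : ℕ} {u : B n} (hu : Fixes j u) : Fixes j u⁻¹ := fun x hx => by
  conv_lhs => rw [← hu x hx]
  simp

theorem fixes_reflection {j : ℕ} {a b : Fin n × ℤˣ} (ha : (a.1 : ℕ) < j) (hb : (b.1 : ℕ) < j) :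
    Fixes j (reflection a b) := fun x hx =>
  reflection_of_ne (fun h => by rw [h] at hx; omega) (fun h => by rw [h] at hx; omega)

theorem Fixes.lt {j : ℕ} {u : B n} (hu : Fixes j u) {x : Fin n × ℤˣ} (hx : (x.1 : ℕ) < j) :
    ((u.1 x).1 : ℕ) < j := by
  by_contra h
  have apply_eq := hu.inv _ (not_lt.1 h)
  rw [inv_apply_self] at apply_eq
  rw [← apply_eq] at h
  exact h hx

theorem fixes_zero_iff {w : B n} : Fixes 0 w ↔ w = 1 :=
  ⟨fun h => B_ext fun x => h x (Nat.zero_le _), fun h => h ▸ fixes_one 0⟩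

theorem fixes_top (w : B n) : Fixes n w := fun x hx => absurd x.1.2 (not_lt.2 hx)

theorem fixes_of_succ {j : ℕ} {w : B n} (hw : Fixes (j + 1) w) (y : Fin n × ℤˣ)
    (hy : (y.1 : ℕ) = j) (h : w.1 y = y) : Fixes j w := by
  intro x hx
  rcases hx.lt_or_eq with hx | hx
  · exact hw x hx
  · rcases eq_or_eq_bar_of_fst_eq (x := x) (y := y) (Fin.ext (by omega)) with rfl | rfl
    · exact h
    · rw [apply_bar, h]

theorem Fixes.mul_reflection {j : ℕ} {w : B n} (hw : Fixes (j + 1) w) {b : Fin n × ℤˣ}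
    (hb : (b.1 : ℕ) = j) : Fixes j (w * reflection ((w⁻¹).1 b) b) := by
  have hlt : (((w⁻¹).1 b).1 : ℕ) < j + 1 := hw.inv.lt (by omega)
  refine fixes_of_succ (hw.mul (fixes_reflection hlt (by omega))) b hb ?_
  rw [mul_apply, reflection_right, apply_inv_self]

end SignedPermutations

/-! ### Absolute length as codimension of the fixed space -/

section Codimension

variable {n : ℕ}

/-- The odd functions on the signed indices that are invariant under `w`: the fixed space of `w` in
the dual of the reflection representation. -/
def invariants (w : B n) : Submodule ℚ (Fin n × ℤˣ → ℚ) where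
  carrier := {f | (∀ x, f (bar x) = -f x) ∧ ∀ x, f (w.1 x) = f x}
  zero_mem' := by simp
  add_mem' := by
    rintro f g ⟨hf, hf'⟩ ⟨hg, hg'⟩
    exact ⟨fun x => by simp [hf, hg, add_comm], fun x => by simp [hf', hg']⟩
  smul_mem' := by
    rintro r f ⟨hf, hf'⟩
    exact ⟨fun x => by simp [hf], fun x => by simp [hf']⟩

theorem mul_mem_invariants {u v : B n} {f : Fin n × ℤˣ → ℚ} (hu : f ∈ invariants u)
    (hv : f ∈ invariants v) : f ∈ invariants (u * v) :=
  ⟨hu.1, fun x => by rw [mul_apply, hu.2, hv.2]⟩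

theorem odd_apply_reflection {f : Fin n × ℤˣ → ℚ} (hf : ∀ x, f (bar x) = -f x)
    {a b : Fin n × ℤˣ} (h : f a = f b) (x : Fin n × ℤˣ) : f ((reflection a b).1 x) = f x := by
  rw [reflection_apply, reflectionFun]
  split_ifs <;> simp_all

theorem reflection_mem_invariants {f : Fin n × ℤˣ → ℚ} (hf : ∀ x, f (bar x) = -f x)
    {a b : Fin n × ℤˣ} (h : f a = f b) : f ∈ invariants (reflection a b) :=
  ⟨hf, odd_apply_reflection hf h⟩

theorem sum_sub_mul_eq_zero_of_mem_invariants {c : B n} {a b : Fin n × ℤˣ}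
    {f g : Fin n × ℤˣ → ℚ} (hf : f ∈ invariants c) (hg : g ∈ invariants (c * reflection a b)) :
    ∑ x, (g ((reflection a b).1 x) - g x) * f x = 0 := by
  have apply_eq : ∀ x, g (c.1 x) = g ((reflection a b).1 x) := fun x => by
    rw [← hg.2 ((reflection a b).1 x), mul_apply, reflection_reflection_apply]
  have reindex := Equiv.sum_comp c.1 fun x => g x * f x
  simp only [apply_eq, hf.2] at reindex
  simp only [sub_mul, Finset.sum_sub_distrib, reindex, sub_self]

theorem sum_sub_mul_sub_reflection {f g : Fin n × ℤˣ → ℚ} (hf : ∀ x, f (bar x) = -f x)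
    (hg : ∀ x, g (bar x) = -g x) (a b : Fin n × ℤˣ) :
    ∑ x, (g ((reflection a b).1 x) - g x) * (f x - f ((reflection a b).1 x)) =
      ({a, b, bar a, bar b} : Finset (Fin n × ℤˣ)).card * ((g b - g a) * (f a - f b)) := by
  have summand_eq : ∀ x, (g ((reflection a b).1 x) - g x) * (f x - f ((reflection a b).1 x)) =
      if x ∈ ({a, b, bar a, bar b} : Finset (Fin n × ℤˣ)) then (g b - g a) * (f a - f b)
        else 0 := fun x => by
    simp only [Finset.mem_insert, Finset.mem_singleton]
    split_ifs with h
    · rcases h with rfl | rfl | rfl | rfl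
      · rw [reflection_left]
      · rw [reflection_right]; ring
      · rw [apply_bar, reflection_left, hg, hg, hf, hf]; ring
      · rw [apply_bar, reflection_right, hg, hg, hf, hf]; ring
    · simp only [not_or] at h
      rw [reflection_apply, reflectionFun, if_neg h.1, if_neg h.2.1, if_neg h.2.2.1,
        if_neg h.2.2.2]
      ring
  simp only [summand_eq, Finset.sum_ite_mem, Finset.univ_inter, Finset.sum_const, nsmul_eq_mul]

theorem eq_of_mem_invariants_mul_reflection {c : B n} {a b : Fin n × ℤˣ} {f g : Fin n × ℤˣ → ℚ}
    (hf : f ∈ invariants c) (hab : f a ≠ f b) (hg : g ∈ invariants (c * reflection a b)) :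
    g a = g b := by
  set R := reflection a b with hR
  have sum_eq : ∑ x, (g (R.1 x) - g x) * f x = 0 :=
    sum_sub_mul_eq_zero_of_mem_invariants hf hg
  have sum_reflected_eq : ∑ x, (g (R.1 x) - g x) * f (R.1 x) = 0 := by
    rw [← Equiv.sum_comp R.1, ← neg_eq_zero, ← Finset.sum_neg_distrib, ← sum_eq]
    refine Finset.sum_congr rfl fun x _ => ?_
    rw [hR, reflection_reflection_apply]
    ring
  have product_eq := sum_sub_mul_sub_reflection hf.1 hg.1 a b
  rw [← hR] at product_eq
  simp only [mul_sub (_ - _), Finset.sum_sub_distrib, sum_eq, sum_reflected_eq, sub_self]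
    at product_eq
  rw [← mul_sub, zero_eq_mul, mul_eq_zero, sub_eq_zero, sub_eq_zero] at product_eq
  exact ((product_eq.resolve_left (by simp)).resolve_right hab).symm

/-- The linear functional `f ↦ f a - f b` on functions of a signed index. -/
def evalSub (a b : Fin n × ℤˣ) : (Fin n × ℤˣ → ℚ) →ₗ[ℚ] ℚ :=
  LinearMap.proj (R := ℚ) (φ := fun _ => ℚ) a - LinearMap.proj (R := ℚ) (φ := fun _ => ℚ) b

theorem mem_ker_evalSub {a b : Fin n × ℤˣ} {f : Fin n × ℤˣ → ℚ} :
    f ∈ LinearMap.ker (evalSub a b) ↔ f a = f b :=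
  sub_eq_zero

theorem invariants_inf_ker_le (c : B n) (a b : Fin n × ℤˣ) :
    invariants c ⊓ LinearMap.ker (evalSub a b) ≤ invariants (c * reflection a b) :=
  fun _ ⟨hf, hab⟩ => mul_mem_invariants hf (reflection_mem_invariants hf.1 (mem_ker_evalSub.1 hab))

theorem invariants_mul_reflection {c : B n} {a b : Fin n × ℤˣ} {f : Fin n × ℤˣ → ℚ}
    (hf : f ∈ invariants c) (hab : f a ≠ f b) :
    invariants (c * reflection a b) = invariants c ⊓ LinearMap.ker (evalSub a b) := by
  refine le_antisymm (fun g hg => ?_) (invariants_inf_ker_le c a b)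
  have apply_eq := eq_of_mem_invariants_mul_reflection hf hab hg
  refine ⟨?_, mem_ker_evalSub.2 apply_eq⟩
  have := mul_mem_invariants hg (reflection_mem_invariants hg.1 apply_eq)
  rwa [mul_assoc, reflection_mul_self, mul_one] at this

section FinrankKer

variable {K V : Type*} [Field K] [AddCommGroup V] [Module K V] [FiniteDimensional K V]

theorem finrank_inf_ker_add_one (U : Submodule K V) (ψ : V →ₗ[K] K) {f : V} (hf : f ∈ U)
    (hψ : ψ f ≠ 0) :
    Module.finrank K (U ⊓ LinearMap.ker ψ : Submodule K V) + 1 = Module.finrank K U := by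
  have restrict_ne_zero : ψ.comp U.subtype ≠ 0 := fun h =>
    hψ (by simpa using LinearMap.congr_fun h ⟨f, hf⟩)
  rw [← Module.Dual.finrank_ker_add_one_of_ne_zero (f := ψ.comp U.subtype) restrict_ne_zero,
    LinearMap.ker_comp,
    (Submodule.equivSubtypeMap U ((LinearMap.ker ψ).comap U.subtype)).finrank_eq,
    Submodule.map_comap_subtype]

theorem finrank_le_inf_ker_add_one (U : Submodule K V) (ψ : V →ₗ[K] K) :
    Module.finrank K U ≤ Module.finrank K (U ⊓ LinearMap.ker ψ : Submodule K V) + 1 := by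
  by_cases h : ∃ f ∈ U, ψ f ≠ 0
  · obtain ⟨f, hf, hψ⟩ := h
    exact (finrank_inf_ker_add_one U ψ hf hψ).ge
  · push Not at h
    rw [inf_eq_left.2 h]
    exact Nat.le_succ _

end FinrankKer

/-- The codimension of the space of invariants of `w` in the space of odd functions. It is computed
by a subtraction of natural numbers, which does not truncate by `codim_add_finrank`. -/
noncomputable def codim (w : B n) : ℕ :=
  Module.finrank ℚ (invariants (1 : B n)) - Module.finrank ℚ (invariants w)

theorem invariants_le_one (w : B n) : invariants w ≤ invariants 1 := fun _ hf =>
  ⟨hf.1, fun _ => rfl⟩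

theorem codim_add_finrank (w : B n) :
    codim w + Module.finrank ℚ (invariants w) = Module.finrank ℚ (invariants (1 : B n)) :=
  Nat.sub_add_cancel (Submodule.finrank_mono (invariants_le_one w))

@[simp] theorem codim_one : codim (1 : B n) = 0 := Nat.sub_self _

theorem codim_mul_reflection {c : B n} {a b : Fin n × ℤˣ} {f : Fin n × ℤˣ → ℚ}
    (hf : f ∈ invariants c) (hab : f a ≠ f b) :
    codim (c * reflection a b) = codim c + 1 := by
  have codim_c := codim_add_finrank c
  have codim_mul := codim_add_finrank (c * reflection a b)
  rw [invariants_mul_reflection hf hab] at codim_mul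
  have := finrank_inf_ker_add_one (invariants c) (evalSub a b) hf (sub_ne_zero.2 hab)
  omega

theorem codim_mul_reflection_le (c : B n) (a b : Fin n × ℤˣ) :
    codim (c * reflection a b) ≤ codim c + 1 := by
  have := codim_add_finrank c
  have := codim_add_finrank (c * reflection a b)
  have := finrank_le_inf_ker_add_one (invariants c) (evalSub a b)
  have := Submodule.finrank_mono (invariants_inf_ker_le c a b)
  omega

theorem codim_le_mul_reflection (c : B n) (a b : Fin n × ℤˣ) :
    codim c ≤ codim (c * reflection a b) + 1 := by
  have := codim_mul_reflection_le (c * reflection a b) a b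
  rwa [mul_assoc, reflection_mul_self, mul_one] at this

/-- The odd function with value `1` at the positive indices in `[s, t)` and `0` outside
`±[s, t)`. -/
def indicator (s t : ℕ) (x : Fin n × ℤˣ) : ℚ :=
  if s ≤ (x.1 : ℕ) ∧ (x.1 : ℕ) < t then ((x.2 : ℤ) : ℚ) else 0

theorem indicator_bar (s t : ℕ) (x : Fin n × ℤˣ) :
    indicator s t (bar x) = -indicator s t x := by
  by_cases h : s ≤ (x.1 : ℕ) ∧ (x.1 : ℕ) < t <;> simp [indicator, h]

theorem indicator_eq_zero {s t : ℕ} {x : Fin n × ℤˣ} (h : (x.1 : ℕ) < s ∨ t ≤ x.1) :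
    indicator s t x = 0 :=
  if_neg (by omega)

theorem indicator_ne_zero {s t : ℕ} {x : Fin n × ℤˣ} (hs : s ≤ x.1) (ht : (x.1 : ℕ) < t) :
    indicator s t x ≠ 0 := by
  rw [indicator, if_pos ⟨hs, ht⟩]
  exact_mod_cast x.2.ne_zero

theorem Fixes.indicator_mem {s t : ℕ} {w : B n} (hw : Fixes s w) :
    indicator s t ∈ invariants w := by
  refine ⟨indicator_bar s t, fun x => ?_⟩
  rcases le_or_gt s x.1 with h | h
  · rw [hw x h]
  · rw [indicator_eq_zero (Or.inl h), indicator_eq_zero (Or.inl (hw.lt h))]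

theorem Fixes.codim_mul_reflection {j : ℕ} {w : B n} (hw : Fixes j w) {a b : Fin n × ℤˣ}
    (hb : b.1 = j) (ha : (a.1 : ℕ) ≤ j) (hab : a ≠ b) :
    codim (w * reflection a b) = codim w + 1 := by
  refine FussB.codim_mul_reflection (hw.indicator_mem (t := j + 1)) ?_
  have hb0 : indicator j (j + 1) b ≠ 0 := indicator_ne_zero hb.ge (by omega)
  rcases ha.lt_or_eq with h | h
  · rw [indicator_eq_zero (Or.inl h)]
    exact hb0.symm
  · obtain rfl : a = bar b := (eq_or_eq_bar_of_fst_eq (Fin.ext (by omega))).resolve_left hab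
    rw [indicator_bar]
    exact fun h => hb0 (self_eq_neg.1 h.symm)

theorem exists_reflection_word_length_eq_codim (j : ℕ) : ∀ w : B n, Fixes j w →
    ∃ L : List (B n), (∀ t ∈ L, t ∈ reflections (simpleB n)) ∧ L.length = codim w ∧
      L.prod = w := by
  induction j with
  | zero =>
    intro w hw
    rw [fixes_zero_iff] at hw
    exact ⟨[], by simp, by simp [hw], by simp [hw]⟩
  | succ j ih =>
    intro w hw
    rcases le_or_gt n j with hj | hj
    · exact ih w fun x hx => absurd x.1.2 (by omega)
    set b : Fin n × ℤˣ := (⟨j, hj⟩, 1)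
    set a := (w⁻¹).1 b
    have fixes_mul : Fixes j (w * reflection a b) := hw.mul_reflection rfl
    obtain ⟨L, hL, hlen, hprod⟩ := ih _ fixes_mul
    rcases eq_or_ne a b with hab | hab
    · rw [hab, reflection_self, mul_one] at hlen hprod
      exact ⟨L, hL, hlen, hprod⟩
    have w_eq : w * reflection a b * reflection a b = w := by
      rw [mul_assoc, reflection_mul_self, mul_one]
    have ha_le : (a.1 : ℕ) ≤ j := Nat.lt_succ_iff.1 (hw.inv.lt (Nat.lt_succ_self j))
    have codim_w := fixes_mul.codim_mul_reflection (b := b) rfl ha_le hab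
    rw [w_eq] at codim_w
    refine ⟨L ++ [reflection a b], ?_, by simp [hlen, codim_w], by simp [hprod, w_eq]⟩
    exact List.forall_mem_append.2
      ⟨hL, List.forall_mem_singleton.2 (reflection_mem_reflections hab)⟩

theorem closure_reflections_simpleB : Submonoid.closure (reflections (simpleB n)) = ⊤ :=
  eq_top_iff.2 fun w _ => by
    obtain ⟨L, hL, -, rfl⟩ := exists_reflection_word_length_eq_codim n w (fixes_top w)
    exact Submonoid.list_prod_mem _ fun t ht => Submonoid.subset_closure (hL t ht)

theorem codim_prod_le_length {L : List (B n)} (hL : ∀ t ∈ L, t ∈ reflections (simpleB n)) :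
    codim L.prod ≤ L.length := by
  induction L using List.reverseRecOn with
  | nil => simp
  | append_singleton L t ih =>
    obtain ⟨a, b, -, rfl⟩ := exists_eq_reflection (hL t (by simp))
    rw [List.prod_append, List.prod_singleton, List.length_append, List.length_singleton]
    exact (codim_mul_reflection_le _ a b).trans
      (Nat.succ_le_succ (ih fun t ht => hL t (List.mem_append_left _ ht)))

theorem absLength_eq_codim (w : B n) : absLength (simpleB n) w = codim w := by
  refine le_antisymm ?_ ?_
  · obtain ⟨L, hL, hlen, rfl⟩ := exists_reflection_word_length_eq_codim n w (fixes_top w)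
    exact hlen ▸ absLength_prod_le_length hL
  · obtain ⟨L, hL, hlen, rfl⟩ := exists_reflection_word closure_reflections_simpleB w
    exact hlen ▸ codim_prod_le_length hL

theorem codim_conj (g w : B n) : codim (g * w * g⁻¹) = codim w := by
  simp only [← absLength_eq_codim, absLength_conj]

end Codimension

/-! ### Lagrange inversion -/

section LagrangeInversion

open PowerSeries

variable {S : Type*} [CommRing S]

/-- The iterates of `A ↦ z φ(A)` starting at `0`, which converge `z`-adically to its fixed
point. -/
noncomputable def treeApprox (φ : Polynomial S) : ℕ → S⟦X⟧
  | 0 => 0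
  | k + 1 => X * Polynomial.aeval (treeApprox φ k) φ

/-- The power series `A` with `A = z φ(A)`. -/
noncomputable def tree (φ : Polynomial S) : S⟦X⟧ :=
  PowerSeries.mk fun k => coeff k (treeApprox φ k)

theorem sub_dvd_aeval_sub_aeval (φ : Polynomial S) (f g : S⟦X⟧) :
    f - g ∣ Polynomial.aeval f φ - Polynomial.aeval g φ := by
  simpa only [Polynomial.aeval_def, Polynomial.eval₂_eq_eval_map] using
    Polynomial.sub_dvd_eval_sub _ _ _

theorem X_pow_dvd_treeApprox_succ_sub (φ : Polynomial S) (k : ℕ) :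
    X ^ (k + 1) ∣ treeApprox φ (k + 1) - treeApprox φ k := by
  induction k with
  | zero => simp [treeApprox]
  | succ k ih =>
    rw [treeApprox, treeApprox, ← mul_sub, pow_succ']
    exact mul_dvd_mul_left _ (ih.trans (sub_dvd_aeval_sub_aeval φ _ _))

theorem X_pow_dvd_treeApprox_sub (φ : Polynomial S) {k m : ℕ} (hkm : k ≤ m) :
    X ^ (k + 1) ∣ treeApprox φ m - treeApprox φ k := by
  induction m, hkm using Nat.le_induction with
  | base => simp
  | succ m hkm ih =>
    simpa using dvd_add
      ((pow_dvd_pow X (Nat.succ_le_succ hkm)).trans (X_pow_dvd_treeApprox_succ_sub φ m)) ih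

theorem X_pow_dvd_tree_sub_treeApprox (φ : Polynomial S) (k : ℕ) :
    X ^ (k + 1) ∣ tree φ - treeApprox φ k := by
  refine X_pow_dvd_iff.2 fun m hm => ?_
  have agree := X_pow_dvd_iff.1
    (X_pow_dvd_treeApprox_sub φ (Nat.lt_succ_iff.1 hm)) m (Nat.lt_succ_self m)
  rw [map_sub, sub_eq_zero] at agree ⊢
  rw [tree, coeff_mk, agree]

theorem tree_eq (φ : Polynomial S) : tree φ = X * Polynomial.aeval (tree φ) φ := by
  ext k
  have fixed_mod : X ^ (k + 1) ∣ X * Polynomial.aeval (tree φ) φ - treeApprox φ (k + 1) := by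
    rw [treeApprox, ← mul_sub]
    exact ((X_pow_dvd_tree_sub_treeApprox φ k).trans (sub_dvd_aeval_sub_aeval φ _ _)).mul_left _
  have tree_mod : X ^ (k + 1) ∣ tree φ - treeApprox φ (k + 1) :=
    (pow_dvd_pow X (Nat.le_succ _)).trans (X_pow_dvd_tree_sub_treeApprox φ (k + 1))
  have diff_mod := dvd_sub tree_mod fixed_mod
  rw [sub_sub_sub_cancel_right] at diff_mod
  simpa [sub_eq_zero] using X_pow_dvd_iff.1 diff_mod k (Nat.lt_succ_self k)

theorem constantCoeff_tree (φ : Polynomial S) : constantCoeff (tree φ) = 0 :=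
  X_dvd_iff.1 ⟨_, tree_eq φ⟩

/-- The power series `N` with `N = 1 + z φ'(A) N`, where `A = z φ(A)`. -/
noncomputable def markedTree (φ : Polynomial S) : S⟦X⟧ :=
  invOfUnit (1 - X * Polynomial.aeval (tree φ) φ.derivative) 1

theorem markedTree_eq (φ : Polynomial S) :
    markedTree φ = 1 + X * Polynomial.aeval (tree φ) φ.derivative * markedTree φ := by
  have inverse := mul_invOfUnit (1 - X * Polynomial.aeval (tree φ) φ.derivative) 1 (by simp)
  rwa [← markedTree, sub_mul, one_mul, sub_eq_iff_eq_add] at inverse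

theorem constantCoeff_markedTree (φ : Polynomial S) : constantCoeff (markedTree φ) = 1 := by
  rw [markedTree_eq]; simp

theorem coeff_pow_succ_self [IsAddTorsionFree S] (φ : Polynomial S) (m : ℕ) :
    (φ ^ (m + 1)).coeff (m + 1) = (φ.derivative * φ ^ m).coeff m := by
  have derivative_coeff := Polynomial.coeff_derivative (φ ^ (m + 1)) m
  rw [Polynomial.derivative_pow_succ, mul_assoc, Polynomial.coeff_C_mul, mul_comm _ (m + 1 : S),
    mul_comm (φ ^ m)] at derivative_coeff
  refine nsmul_right_injective (Nat.succ_ne_zero m) ?_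
  simpa [nsmul_eq_mul] using derivative_coeff.symm

theorem coeff_aeval_tree_mul_markedTree [IsAddTorsionFree S] (φ ψ : Polynomial S) (m : ℕ) :
    coeff m (Polynomial.aeval (tree φ) ψ * markedTree φ) = (ψ * φ ^ m).coeff m := by
  induction m generalizing ψ with
  | zero =>
    have : constantCoeff (Polynomial.aeval (tree φ) ψ) = ψ.coeff 0 := by
      rw [Polynomial.aeval_def, Polynomial.hom_eval₂, constantCoeff_tree]
      simp
    simp [this, constantCoeff_markedTree]
  | succ m ih =>
    have series_eq : Polynomial.aeval (tree φ) ψ * markedTree φ =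
        C (ψ.coeff 0) + X * (C (ψ.coeff 0) *
          (Polynomial.aeval (tree φ) φ.derivative * markedTree φ) +
            Polynomial.aeval (tree φ) (ψ.divX * φ) * markedTree φ) := by
      conv_lhs => rw [← Polynomial.X_mul_divX_add ψ]
      rw [map_add, map_mul, map_mul, Polynomial.aeval_X, Polynomial.aeval_C,
        PowerSeries.algebraMap_apply, Algebra.algebraMap_self_apply]
      linear_combination Polynomial.aeval (tree φ) ψ.divX * markedTree φ * tree_eq φ +
        C (ψ.coeff 0) * markedTree_eq φ
    have coeff_mul_pow_succ : (ψ * φ ^ (m + 1)).coeff (m + 1) =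
        ψ.coeff 0 * (φ.derivative * φ ^ m).coeff m + (ψ.divX * φ * φ ^ m).coeff m := by
      conv_lhs => rw [← Polynomial.X_mul_divX_add ψ]
      rw [add_mul, mul_assoc, Polynomial.coeff_add, Polynomial.coeff_X_mul, Polynomial.coeff_C_mul,
        coeff_pow_succ_self, pow_succ', mul_assoc, add_comm]
    rw [series_eq, map_add, coeff_succ_X_mul, map_add, coeff_C_mul, ih, ih, coeff_mul_pow_succ,
      coeff_C, if_neg (Nat.succ_ne_zero m), zero_add]

theorem coeff_markedTree [IsAddTorsionFree S] (φ : Polynomial S) (m : ℕ) :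
    coeff m (markedTree φ) = (φ ^ m).coeff m := by
  simpa using coeff_aeval_tree_mul_markedTree φ 1 m

end LagrangeInversion

/-! ### Jucys–Murphy elements in the graded group algebra -/

section PolynomialsInAnAlgebra

variable {R A : Type*} [CommSemiring R] [Semiring A] [Algebra R A]

theorem mul_aeval_mem (M : Submodule R A) {g : A} (hg : ∀ f ∈ M, f * g ∈ M) {f : A} (hf : f ∈ M)
    (φ : Polynomial R) : f * Polynomial.aeval g φ ∈ M := by
  induction φ using Polynomial.induction_on with
  | C r =>
    rw [Polynomial.aeval_C, ← Algebra.commutes, ← Algebra.smul_def]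
    exact M.smul_mem r hf
  | add φ ψ hφ hψ =>
    rw [map_add, mul_add]
    exact M.add_mem hφ hψ
  | monomial m r ih =>
    rw [pow_succ, ← mul_assoc, map_mul, Polynomial.aeval_X, ← mul_assoc]
    exact hg _ ih

theorem commute_aeval_right {f g : A} (h : Commute f g) (φ : Polynomial R) :
    Commute f (Polynomial.aeval g φ) := by
  rw [Polynomial.aeval_eq_sum_range]
  exact Commute.sum_right _ _ _ fun p _ => (h.pow_right p).smul_right _

theorem prod_map_mul_of_commute {ι M : Type*} [Monoid M] (f g : ι → M)
    (h : ∀ i j, Commute (f i) (g j)) (l : List ι) :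
    (l.map fun i => f i * g i).prod = (l.map f).prod * (l.map g).prod := by
  induction l with
  | nil => simp
  | cons i l ih =>
    have : Commute (l.map f).prod (g i) :=
      Commute.list_prod_left _ _ (by simpa using fun j _ => h j i)
    simp only [List.map_cons, List.prod_cons, ih]
    rw [mul_assoc, mul_assoc, this.left_comm]

end PolynomialsInAnAlgebra

section GradedGroupAlgebra

open Polynomial

variable {n : ℕ} {S : Type*} [CommRing S]

/-- The coefficient of `w` in degree `codim w`, which is the lowest possible degree for the
elements of `lengthGraded`. -/
noncomputable def leadCoeff (w : B n) : MonoidAlgebra S[X] (B n) →ₗ[S] S where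
  toFun f := (f.coeff w).coeff (codim w)
  map_add' f g := by simp
  map_smul' r f := by simp

theorem leadCoeff_apply (w : B n) (f : MonoidAlgebra S[X] (B n)) :
    leadCoeff w f = (f.coeff w).coeff (codim w) := rfl

theorem leadCoeff_one_one : leadCoeff (1 : B n) (1 : MonoidAlgebra S[X] (B n)) = 1 := by
  simp [leadCoeff_apply, MonoidAlgebra.coeff_one_one]

variable (n S) in
/-- The elements in which every `w` appears in degrees at least its absolute length. -/
noncomputable def lengthGraded : Submodule S (MonoidAlgebra S[X] (B n)) where
  carrier := {f | ∀ w, X ^ codim w ∣ f.coeff w}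
  zero_mem' := by simp
  add_mem' hf hg w := dvd_add (hf w) (hg w)
  smul_mem' r f hf w := by
    rw [MonoidAlgebra.coeff_smul_apply, smul_eq_C_mul]
    exact (hf w).mul_left _

variable (n S) in
/-- The elements supported on the signed permutations that fix the indices from `j` on. -/
noncomputable def supportedBelow (j : ℕ) : Submodule S (MonoidAlgebra S[X] (B n)) where
  carrier := {f | ∀ w, ¬ Fixes j w → f.coeff w = 0}
  zero_mem' := by simp
  add_mem' hf hg w hw := by
    rw [MonoidAlgebra.coeff_add, Finsupp.add_apply, hf w hw, hg w hw, add_zero]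
  smul_mem' r f hf w hw := by rw [MonoidAlgebra.coeff_smul_apply, hf w hw, smul_zero]

theorem one_mem_lengthGraded : 1 ∈ lengthGraded n S := by
  classical
  intro w
  rw [MonoidAlgebra.one_def, MonoidAlgebra.coeff_single, Finsupp.single_apply]
  split_ifs with hw
  · simp [← hw]
  · exact dvd_zero _

theorem one_mem_supportedBelow (j : ℕ) : 1 ∈ supportedBelow n S j := by
  classical
  intro w hw
  rw [MonoidAlgebra.one_def, MonoidAlgebra.coeff_single, Finsupp.single_apply, if_neg]
  rintro rfl
  exact hw (fixes_one j)

noncomputable instance : Fintype (B n) := Fintype.ofFinite _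

open scoped Classical in
variable (n) in
/-- The sum of the signed permutations fixing the indices from `j` on, weighted by `t` to the power
of their absolute length, in degree their absolute length. -/
noncomputable def lengthGen (t : S) (j : ℕ) : MonoidAlgebra S[X] (B n) :=
  ∑ w : B n with Fixes j w, MonoidAlgebra.single w ((C t * X) ^ codim w)

theorem lengthGen_zero (t : S) : lengthGen n t 0 = 1 := by
  simp [lengthGen, fixes_zero_iff, Finset.filter_eq', MonoidAlgebra.one_def]

variable [NeZero n]

/-- The positive signed index with absolute value `j` (counted from `0`, so that only `j < n` is
meaningful). -/
def pt (n : ℕ) [NeZero n] (j : ℕ) : Fin n × ℤˣ := (Fin.ofNat n j, 1)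

theorem pt_fst {j : ℕ} (hj : j < n) : ((pt n j).1 : ℕ) = j := Nat.mod_eq_of_lt hj

@[simp] theorem pt_snd (j : ℕ) : (pt n j).2 = 1 := rfl

/-- The signed indices of absolute value at most `j`, other than `j`. -/
def lower (n : ℕ) [NeZero n] (j : ℕ) : Finset (Fin n × ℤˣ) := {a | (a.1 : ℕ) ≤ j ∧ a ≠ pt n j}

theorem mem_lower {j : ℕ} {a : Fin n × ℤˣ} : a ∈ lower n j ↔ (a.1 : ℕ) ≤ j ∧ a ≠ pt n j := by
  simp [lower]

variable (n S) in
/-- The Jucys–Murphy element: the sum of the reflections of the `(j + 1)`-st signed permutation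
group that are not in the `j`-th, in degree `1`. -/
noncomputable def jm (j : ℕ) : MonoidAlgebra S[X] (B n) :=
  ∑ a ∈ lower n j, MonoidAlgebra.single (reflection a (pt n j)) X

theorem coeff_mul_jm (f : MonoidAlgebra S[X] (B n)) (j : ℕ) (w : B n) :
    (f * jm n S j).coeff w = (∑ a ∈ lower n j, f.coeff (w * reflection a (pt n j))) * X := by
  simp only [jm, Finset.mul_sum, MonoidAlgebra.coeff_sum, Finsupp.finsetSum_apply,
    MonoidAlgebra.coeff_mul_single_apply, reflection_inv, Finset.sum_mul]

theorem mul_jm_mem_lengthGraded (j : ℕ) :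
    ∀ f ∈ lengthGraded n S, f * jm n S j ∈ lengthGraded n S := by
  intro f hf w
  rw [coeff_mul_jm, Finset.sum_mul]
  refine Finset.dvd_sum fun a _ => ?_
  calc X ^ codim w ∣ X ^ (codim (w * reflection a (pt n j)) + 1) :=
        pow_dvd_pow _ (codim_le_mul_reflection w a _)
    _ ∣ f.coeff (w * reflection a (pt n j)) * X := by
      rw [pow_succ]
      exact mul_dvd_mul_right (hf _) _

theorem mul_jm_mem_supportedBelow {i j : ℕ} (hij : i < j) (hj : j ≤ n) :
    ∀ f ∈ supportedBelow n S j, f * jm n S i ∈ supportedBelow n S j := by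
  intro f hf w hw
  rw [coeff_mul_jm, Finset.sum_eq_zero, zero_mul]
  refine fun a ha => hf _ fun hwa => hw ?_
  have fixes_refl : Fixes j (reflection a (pt n i)) :=
    fixes_reflection ((mem_lower.1 ha).1.trans_lt hij) (by rwa [pt_fst (hij.trans_le hj)])
  simpa only [mul_assoc, reflection_mul_self, mul_one] using hwa.mul fixes_refl

open scoped Classical in
/-- The signed indices `a` for which multiplying by the reflection of `a` and `j` shortens `w`. -/
noncomputable def descents (w : B n) (j : ℕ) : Finset (Fin n × ℤˣ) :=
  {a ∈ lower n j | codim (w * reflection a (pt n j)) < codim w}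

theorem mem_descents {w : B n} {j : ℕ} {a : Fin n × ℤˣ} : a ∈ descents w j ↔
    a ∈ lower n j ∧ codim (w * reflection a (pt n j)) < codim w := by
  simp [descents]

theorem leadCoeff_mul_jm {f : MonoidAlgebra S[X] (B n)} (hf : f ∈ lengthGraded n S) (j : ℕ)
    (w : B n) : leadCoeff w (f * jm n S j) =
      ∑ a ∈ descents w j, leadCoeff (w * reflection a (pt n j)) f := by
  classical
  rw [descents, Finset.sum_filter, leadCoeff_apply, coeff_mul_jm]
  rcases hd : codim w with _ | d
  · simp
  · rw [coeff_mul_X, finsetSum_coeff]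
    refine Finset.sum_congr rfl fun a _ => ?_
    have := codim_le_mul_reflection w a (pt n j)
    split_ifs with hlt
    · rw [leadCoeff_apply, show codim (w * reflection a (pt n j)) = d by omega]
    · exact X_pow_dvd_iff.1 (hf _) d (by omega)

variable (n) in
/-- The product of the values of `φ` at the first `j` Jucys–Murphy elements. -/
noncomputable def jmProd (φ : S[X]) : ℕ → MonoidAlgebra S[X] (B n)
  | 0 => 1
  | j + 1 => jmProd φ j * aeval (jm n S j) φ

theorem jmProd_mem_lengthGraded (φ : S[X]) (j : ℕ) : jmProd n φ j ∈ lengthGraded n S := by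
  induction j with
  | zero => exact one_mem_lengthGraded
  | succ j ih => exact mul_aeval_mem _ (mul_jm_mem_lengthGraded j) ih φ

theorem jmProd_mem_supportedBelow (φ : S[X]) {j m : ℕ} (hj : j ≤ m) (hm : m ≤ n) :
    jmProd n φ j ∈ supportedBelow n S m := by
  induction j with
  | zero => exact one_mem_supportedBelow m
  | succ j ih =>
    exact mul_aeval_mem _ (mul_jm_mem_supportedBelow (Nat.lt_of_succ_le hj) hm)
      (ih (Nat.le_of_succ_le hj)) φ

theorem codim_reflection_pt {j : ℕ} (hj : j < n) {a : Fin n × ℤˣ} (ha : (a.1 : ℕ) ≤ j)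
    (hne : a ≠ pt n j) : codim (reflection a (pt n j)) = 1 := by
  simpa using (fixes_one j).codim_mul_reflection (pt_fst hj) ha hne

theorem Fixes.codim_mul_reflection_eq_add {j : ℕ} (hj : j < n) {w : B n} (hw : Fixes j w)
    {a : Fin n × ℤˣ} (ha : (a.1 : ℕ) ≤ j) :
    codim (w * reflection a (pt n j)) = codim w + codim (reflection a (pt n j)) := by
  rcases eq_or_ne a (pt n j) with rfl | hne
  · simp
  · rw [hw.codim_mul_reflection (pt_fst hj) ha hne, codim_reflection_pt hj ha hne]

theorem aeval_jm_one_add {j : ℕ} (hj : j < n) (t : S) :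
    aeval (jm n S j) (1 + C t * X) = ∑ a : Fin n × ℤˣ with (a.1 : ℕ) < j + 1,
      MonoidAlgebra.single (reflection a (pt n j)) ((C t * X) ^ codim (reflection a (pt n j))) := by
  classical
  have indices_eq : ({a | (a.1 : ℕ) < j + 1} : Finset (Fin n × ℤˣ)) =
      insert (pt n j) (lower n j) := by
    ext a
    by_cases h : a = pt n j <;> simp [h, mem_lower, pt_fst hj]
  rw [indices_eq, Finset.sum_insert (by simp [mem_lower]), reflection_self, codim_one, pow_zero,
    map_add, map_one, ← MonoidAlgebra.one_def, map_mul, aeval_C, aeval_X, ← Algebra.smul_def, jm,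
    Finset.smul_sum]
  congr 1
  refine Finset.sum_congr rfl fun a ha => ?_
  obtain ⟨ha_le, ha_ne⟩ := mem_lower.1 ha
  rw [codim_reflection_pt hj ha_le ha_ne, pow_one, MonoidAlgebra.smul_single, smul_eq_C_mul]

/-- Every `w` fixing the indices from `j + 1` on is uniquely `v * reflection a (pt n j)` with `v`
fixing the indices from `j` on, namely for `a = w⁻¹ (pt n j)`. -/
theorem lengthGen_succ (t : S) {j : ℕ} (hj : j < n) :
    lengthGen n t (j + 1) = lengthGen n t j * aeval (jm n S j) (1 + C t * X) := by
  classical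
  rw [aeval_jm_one_add hj, lengthGen, lengthGen, Finset.sum_mul_sum, ← Finset.sum_product']
  symm
  refine Finset.sum_bij' (fun p _ => p.1 * reflection p.2 (pt n j))
    (fun w _ => (w * reflection ((w⁻¹).1 (pt n j)) (pt n j), (w⁻¹).1 (pt n j)))
    ?_ ?_ ?_ (by simp [mul_assoc]) ?_
  · rintro ⟨w, a⟩ h
    simp only [Finset.mem_product, Finset.mem_filter_univ] at h ⊢
    exact (h.1.mono (Nat.le_succ j)).mul (fixes_reflection h.2 (by simp [pt_fst hj]))
  · intro w hw
    simp only [Finset.mem_product, Finset.mem_filter_univ] at hw ⊢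
    exact ⟨hw.mul_reflection (pt_fst hj), hw.inv.lt (by simp [pt_fst hj])⟩
  · rintro ⟨w, a⟩ h
    simp only [Finset.mem_product, Finset.mem_filter_univ] at h
    have inv_apply_pt : ((w * reflection a (pt n j))⁻¹).1 (pt n j) = a := by
      rw [mul_inv_rev, reflection_inv, mul_apply, h.1.inv _ (pt_fst hj).ge, reflection_right]
    simp only [inv_apply_pt, mul_assoc, reflection_mul_self, mul_one]
  · rintro ⟨w, a⟩ h
    simp only [Finset.mem_product, Finset.mem_filter_univ] at h
    rw [MonoidAlgebra.single_mul_single, ← pow_add,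
      h.1.codim_mul_reflection_eq_add hj (Nat.lt_succ_iff.1 h.2)]

theorem Fixes.apply_mem_lower {j : ℕ} (hj : j < n) {w : B n} (hw : Fixes j w) {a : Fin n × ℤˣ}
    (ha : a ∈ lower n j) : w.1 a ∈ lower n j := by
  rw [mem_lower] at ha ⊢
  refine ⟨Nat.lt_succ_iff.1 ((hw.mono (Nat.le_succ j)).lt (Nat.lt_succ_iff.2 ha.1)), ?_⟩
  rw [← hw (pt n j) (pt_fst hj).ge]
  exact fun h => ha.2 (w.1.injective h)

theorem Fixes.single_commute_jm {j : ℕ} (hj : j < n) {w : B n} (hw : Fixes j w) (r : S[X]) :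
    Commute (MonoidAlgebra.single w r) (jm n S j) := by
  rw [Commute, SemiconjBy, jm, Finset.mul_sum, Finset.sum_mul]
  simp only [MonoidAlgebra.single_mul_single]
  refine Finset.sum_bij' (fun a _ => w.1 a) (fun a _ => (w⁻¹).1 a)
    (fun a ha => hw.apply_mem_lower hj ha) (fun a ha => hw.inv.apply_mem_lower hj ha)
    (by simp) (by simp) fun a _ => ?_
  rw [FussB.mul_reflection, hw (pt n j) (pt_fst hj).ge, mul_comm r]

theorem lengthGen_commute_jm (t : S) {j : ℕ} (hj : j < n) :
    Commute (lengthGen n t j) (jm n S j) := by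
  classical
  exact Commute.sum_left _ _ _ fun w hw => (Finset.mem_filter.1 hw).2.single_commute_jm hj _

theorem prod_map_lengthGen (ts : List S) {j : ℕ} (hj : j ≤ n) :
    (ts.map fun t => lengthGen n t j).prod = jmProd n (ts.map fun t => 1 + C t * X).prod j := by
  induction j with
  | zero => simp [lengthGen_zero, jmProd]
  | succ j ih =>
    have hjn : j < n := hj
    simp only [lengthGen_succ _ hjn]
    rw [prod_map_mul_of_commute, ih hjn.le, jmProd, map_list_prod, List.map_map]
    · rfl
    · exact fun t u => commute_aeval_right (lengthGen_commute_jm t hjn) _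

end GradedGroupAlgebra

/-! ### Cycles on intervals -/

section Intervals

variable {n : ℕ} [NeZero n]

theorem pt_inj {i j : ℕ} (hi : i < n) (hj : j < n) : pt n i = pt n j ↔ i = j :=
  ⟨fun h => by rw [← pt_fst hi, ← pt_fst hj, h], fun h => by rw [h]⟩

theorem eq_pt_iff {j : ℕ} (hj : j < n) {a : Fin n × ℤˣ} : a = pt n j ↔ (a.1 : ℕ) = j ∧ a.2 = 1 := by
  rw [Prod.ext_iff, Fin.ext_iff, pt_fst hj, pt_snd]

theorem indicator_pt (s t : ℕ) {j : ℕ} (hj : j < n) :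
    indicator s t (pt n j) = if s ≤ j ∧ j < t then 1 else 0 := by
  simp [indicator, pt_fst hj]

omit [NeZero n] in
theorem indicator_add_indicator {r s t : ℕ} (hrs : r ≤ s) (hst : s ≤ t) :
    (indicator r s + indicator s t : Fin n × ℤˣ → ℚ) = indicator r t := by
  ext x
  simp only [Pi.add_apply, indicator]
  split_ifs <;> first | omega | simp

variable (n) in
/-- The sign change at the index `j`. -/
def sgn (j : ℕ) : B n := reflection (bar (pt n j)) (pt n j)

theorem sgn_apply_self (j : ℕ) : (sgn n j).1 (pt n j) = bar (pt n j) := reflection_right _ _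

theorem sgn_apply_of_ne {j : ℕ} {x : Fin n × ℤˣ} (h : x.1 ≠ (pt n j).1) : (sgn n j).1 x = x :=
  reflection_of_ne h h

theorem sgn_mul_self (j : ℕ) : sgn n j * sgn n j = 1 := reflection_mul_self _ _

theorem fixes_sgn {j : ℕ} (hj : j < n) : Fixes (j + 1) (sgn n j) :=
  fixes_reflection (by simp [pt_fst hj]) (by simp [pt_fst hj])

variable (n) in
/-- The cycle `s → s + 1 → ⋯ → s + L → s` and its opposite. -/
def cyc (s : ℕ) : ℕ → B n
  | 0 => 1
  | L + 1 => cyc s L * reflection (pt n (s + L)) (pt n (s + L + 1))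

theorem cyc_add (s a b : ℕ) : cyc n s (a + b) = cyc n s a * cyc n (s + a) b := by
  induction b with
  | zero => simp [cyc]
  | succ b ih => rw [← add_assoc, cyc, cyc, ih, mul_assoc, add_assoc s a b]

theorem fixes_cyc {s L : ℕ} (h : s + L < n) : Fixes (s + L + 1) (cyc n s L) := by
  induction L with
  | zero => exact fixes_one _
  | succ L ih =>
    exact ((ih (by omega)).mono (by omega)).mul
      (fixes_reflection (by rw [pt_fst (by omega)]; omega) (by rw [pt_fst (by omega)]; omega))

theorem Fixes.mul_cyc {s L : ℕ} (h : s + L < n) {u : B n} (hu : Fixes s u) :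
    Fixes (s + L + 1) (u * cyc n s L) :=
  (hu.mono (by omega)).mul (fixes_cyc h)

theorem Fixes.mul_cyc_mul_sgn {s L : ℕ} (h : s + L < n) {u : B n} (hu : Fixes s u) :
    Fixes (s + L + 1) (u * cyc n s L * sgn n (s + L)) :=
  (hu.mul_cyc h).mul (fixes_sgn h)

theorem cyc_apply_pt_of_lt {s L : ℕ} (h : s + L < n) {i : ℕ} (hi : i < s) :
    (cyc n s L).1 (pt n i) = pt n i := by
  induction L with
  | zero => rfl
  | succ L ih =>
    have fst_ne {k : ℕ} (hk : i < k) (hkn : k < n) : (pt n i).1 ≠ (pt n k).1 := by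
      rw [Ne, Fin.ext_iff, pt_fst (by omega), pt_fst hkn]
      omega
    rw [cyc, mul_apply, reflection_of_ne (fst_ne (by omega) (by omega))
      (fst_ne (by omega) (by omega)), ih (by omega)]

theorem cyc_apply_last (s L : ℕ) : (cyc n s L).1 (pt n (s + L)) = pt n s := by
  induction L with
  | zero => rfl
  | succ L ih => rw [cyc, mul_apply, ← add_assoc, reflection_right, ih]

theorem cyc_mul_reflection {s L q : ℕ} (h : s + L < n) (hq : q < L) :
    cyc n s L * reflection (pt n (s + q)) (pt n (s + L)) =
      cyc n s q * cyc n (s + q + 1) (L - (q + 1)) := by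
  obtain ⟨m, rfl⟩ : ∃ m, L = q + 1 + m := ⟨L - (q + 1), by omega⟩
  have last_eq : s + (q + 1 + m) = s + q + 1 + m := by omega
  rw [Nat.add_sub_cancel_left, last_eq, cyc_add, cyc, mul_assoc, ← add_assoc,
    mul_reflection (cyc n (s + q + 1) m), cyc_apply_pt_of_lt (by omega) (by omega),
    cyc_apply_last, ← mul_assoc, mul_assoc (cyc n s q), reflection_mul_self, mul_one]

theorem cyc_mul_sgn_mul_reflection_bar {s L q : ℕ} (h : s + L < n) (hq : q < L) :
    cyc n s L * sgn n (s + L) * reflection (bar (pt n (s + q))) (pt n (s + L)) =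
      cyc n s q * cyc n (s + q + 1) (L - (q + 1)) * sgn n (s + L) := by
  have fst_ne : (pt n (s + q)).1 ≠ (pt n (s + L)).1 := by
    rw [Ne, Fin.ext_iff, pt_fst (by omega), pt_fst h]
    omega
  rw [mul_assoc, mul_reflection, apply_bar, sgn_apply_of_ne fst_ne, sgn_apply_self,
    reflection_bar_bar, ← mul_assoc, cyc_mul_reflection h hq]

theorem sgn_mul_reflection (i j : ℕ) : sgn n j * reflection (pt n i) (pt n j) =
    reflection (pt n i) (pt n j) * sgn n i := by
  rw [sgn, sgn, mul_reflection (reflection (pt n i) (pt n j)), apply_bar, reflection_left]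

theorem cyc_mul_sgn_mul_reflection {s L q : ℕ} (h : s + L < n) (hq : q < L) :
    cyc n s L * sgn n (s + L) * reflection (pt n (s + q)) (pt n (s + L)) =
      cyc n s q * sgn n (s + q) * cyc n (s + q + 1) (L - (q + 1)) := by
  rw [mul_assoc, sgn_mul_reflection, ← mul_assoc, cyc_mul_reflection h hq, sgn, mul_assoc,
    mul_reflection, apply_bar, cyc_apply_pt_of_lt (by omega) (by omega), mul_assoc]

theorem mem_invariants_cyc {s L : ℕ} {f : Fin n × ℤˣ → ℚ} (hf : ∀ x, f (bar x) = -f x) {v : ℚ}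
    (hv : ∀ x, s ≤ x → x ≤ s + L → f (pt n x) = v) : f ∈ invariants (cyc n s L) := by
  induction L with
  | zero => exact ⟨hf, fun _ => rfl⟩
  | succ L ih =>
    refine mul_mem_invariants (ih fun x hsx hxL => hv x hsx (by omega))
      (reflection_mem_invariants hf ?_)
    rw [hv _ (by omega) (by omega), hv _ (by omega) (by omega)]

theorem indicator_mem_invariants_mul_cyc {s L : ℕ} (h : s + L < n) {u : B n} (hu : Fixes s u) :
    indicator s (s + L + 1) ∈ invariants (u * cyc n s L) :=
  mul_mem_invariants hu.indicator_mem <| mem_invariants_cyc (indicator_bar _ _) (v := 1)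
    fun x hsx hxL => by rw [indicator_pt _ _ (by omega), if_pos (by omega)]

theorem codim_mul_cyc {s L : ℕ} (h : s + L < n) {u : B n} (hu : Fixes s u) :
    codim (u * cyc n s L) = codim u + L := by
  induction L with
  | zero => simp [cyc]
  | succ L ih =>
    rw [cyc, ← mul_assoc, (hu.mul_cyc (by omega)).codim_mul_reflection (pt_fst (by omega))
      (by rw [pt_fst (by omega)]; omega) (by rw [Ne, pt_inj (by omega) (by omega)]; omega),
      ih (by omega), add_assoc]

theorem codim_mul_cyc_mul_sgn {s L : ℕ} (h : s + L < n) {u : B n} (hu : Fixes s u) :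
    codim (u * cyc n s L * sgn n (s + L)) = codim u + L + 1 := by
  rw [sgn, codim_mul_reflection (indicator_mem_invariants_mul_cyc h hu), codim_mul_cyc h hu]
  rw [indicator_bar, indicator_pt _ _ h, if_pos (by omega)]
  norm_num

omit [NeZero n] in
theorem indicator_eq_one_iff {s t : ℕ} {x : Fin n × ℤˣ} :
    indicator s t x = 1 ↔ s ≤ (x.1 : ℕ) ∧ (x.1 : ℕ) < t ∧ x.2 = 1 := by
  rcases Int.units_eq_one_or x.2 with hx | hx <;> simp [indicator, hx]
  · grind

theorem mem_image_pt {s L : ℕ} (h : s + L ≤ n) {a : Fin n × ℤˣ} :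
    a ∈ (Finset.range L).image (fun q => pt n (s + q)) ↔
      s ≤ (a.1 : ℕ) ∧ (a.1 : ℕ) < s + L ∧ a.2 = 1 := by
  simp only [Finset.mem_image, Finset.mem_range]
  constructor
  · rintro ⟨q, hq, rfl⟩
    rw [pt_fst (by omega)]
    exact ⟨by omega, by omega, rfl⟩
  · rintro ⟨hs, hL, ha⟩
    exact ⟨a.1 - s, by omega, ((eq_pt_iff (by omega)).2 ⟨by omega, ha⟩).symm⟩

theorem mem_image_bar_pt {s L : ℕ} (h : s + L ≤ n) {a : Fin n × ℤˣ} :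
    a ∈ (Finset.range L).image (fun q => bar (pt n (s + q))) ↔
      s ≤ (a.1 : ℕ) ∧ (a.1 : ℕ) < s + L ∧ a.2 = -1 := by
  rw [← bar_fst a, ← neg_inj, neg_neg, ← bar_snd a, ← mem_image_pt h]
  simp only [Finset.mem_image, bar_eq_iff]

theorem injOn_pt_add {s L : ℕ} (h : s + L ≤ n) :
    Set.InjOn (fun q => pt n (s + q)) (Finset.range L) := by
  intro a ha b hb hab
  rw [Finset.coe_range, Set.mem_Iio] at ha hb
  have := (pt_inj (by omega) (by omega)).1 hab
  omega

theorem pt_mem_lower {i j : ℕ} (hij : i < j) (hj : j < n) : pt n i ∈ lower n j := by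
  rw [mem_lower, Ne, pt_inj (by omega) hj, pt_fst (by omega)]
  omega

theorem bar_pt_mem_lower {i j : ℕ} (hij : i ≤ j) (hj : j < n) : bar (pt n i) ∈ lower n j := by
  rw [mem_lower, bar_fst, pt_fst (by omega)]
  exact ⟨hij, fun h => by simpa using congrArg Prod.snd h⟩

theorem descents_mul_cyc {s L : ℕ} (h : s + L < n) {u : B n} (hu : Fixes s u) :
    descents (u * cyc n s L) (s + L) = (Finset.range L).image fun q => pt n (s + q) := by
  ext a
  constructor
  · rw [mem_descents, mem_image_pt h.le, mem_lower]
    rintro ⟨⟨ha_le, ha_ne⟩, hlt⟩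
    have indicator_eq_one : indicator s (s + L + 1) a = 1 := by
      by_contra hne
      have := codim_mul_reflection (a := a) (b := pt n (s + L))
        (indicator_mem_invariants_mul_cyc h hu)
        (by rwa [indicator_pt _ _ h, if_pos (by omega)])
      omega
    obtain ⟨ha_ge, -, ha_pos⟩ := indicator_eq_one_iff.1 indicator_eq_one
    rw [Ne, eq_pt_iff h] at ha_ne
    exact ⟨ha_ge, by grind, ha_pos⟩
  · intro ha
    obtain ⟨q, hq, rfl⟩ := Finset.mem_image.1 ha
    have hqL := Finset.mem_range.1 hq
    rw [mem_descents, mul_assoc, cyc_mul_reflection h hqL, ← mul_assoc,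
      codim_mul_cyc (by omega) (hu.mul_cyc (by omega)),
      codim_mul_cyc (by omega) hu, codim_mul_cyc h hu]
    exact ⟨pt_mem_lower (by omega) h, by omega⟩

theorem indicator_mem_invariants_mul_cyc_mul_sgn {s L : ℕ} (h : s + L < n) {u : B n}
    (hu : indicator 0 s ∈ invariants u) :
    indicator 0 s ∈ invariants (u * cyc n s L * sgn n (s + L)) := by
  have vanishes (x : ℕ) (hsx : s ≤ x) (hxL : x ≤ s + L) : indicator 0 s (pt n x) = 0 := by
    rw [indicator_pt _ _ (by omega), if_neg (by omega)]
  refine mul_mem_invariants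
    (mul_mem_invariants hu (mem_invariants_cyc (indicator_bar _ _) vanishes))
    (reflection_mem_invariants (indicator_bar _ _) ?_)
  rw [indicator_bar, vanishes _ (by omega) le_rfl, neg_zero]

theorem descents_mul_cyc_mul_sgn {s L : ℕ} (h : s + L < n) {u : B n} (hu : Fixes s u)
    (hinv : indicator 0 s ∈ invariants u) :
    descents (u * cyc n s L * sgn n (s + L)) (s + L) =
      ((Finset.range L).image fun q => pt n (s + q)) ∪
        (Finset.range (L + 1)).image fun q => bar (pt n (s + q)) := by
  ext a
  constructor
  · rw [mem_descents, Finset.mem_union, mem_image_pt h.le, mem_image_bar_pt h, mem_lower, Ne,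
      eq_pt_iff h]
    rintro ⟨⟨ha_le, ha_ne⟩, hlt⟩
    have ha_ge : s ≤ (a.1 : ℕ) := by
      by_contra! ha_lt
      have := codim_mul_reflection (a := a) (b := pt n (s + L))
        (indicator_mem_invariants_mul_cyc_mul_sgn h hinv) (by
          rw [indicator_pt _ _ h, if_neg (by omega)]
          exact indicator_ne_zero (Nat.zero_le _) ha_lt)
      omega
    rcases Int.units_eq_one_or a.2 with ha | ha
    · exact Or.inl ⟨ha_ge, by grind, ha⟩
    · exact Or.inr ⟨ha_ge, by omega, ha⟩
  · simp only [Finset.mem_union, Finset.mem_image, Finset.mem_range, mem_descents,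
      codim_mul_cyc_mul_sgn h hu]
    rintro (⟨q, hq, rfl⟩ | ⟨q, hq, rfl⟩)
    · refine ⟨pt_mem_lower (by omega) h, ?_⟩
      rw [mul_assoc u, mul_assoc u, cyc_mul_sgn_mul_reflection h hq, ← mul_assoc, ← mul_assoc,
        codim_mul_cyc (by omega) (hu.mul_cyc_mul_sgn (by omega)),
        codim_mul_cyc_mul_sgn (by omega) hu]
      omega
    · refine ⟨bar_pt_mem_lower (by omega) h, ?_⟩
      rcases (Nat.lt_succ_iff.1 hq).lt_or_eq with hq | rfl
      · have last_eq : s + L = s + q + 1 + (L - (q + 1)) := by omega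
        rw [mul_assoc u, mul_assoc u, cyc_mul_sgn_mul_reflection_bar h hq, ← mul_assoc,
          ← mul_assoc]
        nth_rw 1 [last_eq]
        rw [codim_mul_cyc_mul_sgn (by omega) (hu.mul_cyc (by omega)),
          codim_mul_cyc (by omega) hu]
        omega
      · rw [← sgn, mul_assoc, sgn_mul_self, mul_one, codim_mul_cyc h hu]
        omega

end Intervals

/-! ### Products of blocks -/

section Blocks

open Polynomial

variable {n : ℕ} [NeZero n] {S : Type*} [CommRing S]

/-- `BlockProd φ s ν G u` says that `u` is a product of cycles on consecutive intervals covering the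
first `s` indices, at most one of them (and exactly one if `ν`) being followed by a sign change, and
that `G` is its weight: a cycle on `L + 1` indices contributes the coefficient of degree `L + 1` of
`tree φ`, or of `markedTree φ` if followed by a sign change. -/
inductive BlockProd (φ : S[X]) : ℕ → Bool → S → B n → Prop
  | one : BlockProd φ 0 false 1 1
  | mul_cyc {s L : ℕ} {ν : Bool} {G : S} {u : B n} (h : s + L < n) (hu : BlockProd φ s ν G u) :
    BlockProd φ (s + L + 1) ν (G * PowerSeries.coeff (L + 1) (tree φ)) (u * cyc n s L)
  | mul_cyc_mul_sgn {s L : ℕ} {G : S} {u : B n} (h : s + L < n) (hu : BlockProd φ s false G u) :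
    BlockProd φ (s + L + 1) true (G * PowerSeries.coeff (L + 1) (markedTree φ))
      (u * cyc n s L * sgn n (s + L))

namespace BlockProd

variable {φ : S[X]} {s : ℕ} {ν : Bool} {G : S} {u : B n}

theorem fixes (hu : BlockProd φ s ν G u) : Fixes s u := by
  induction hu with
  | one => exact fixes_one 0
  | mul_cyc h _ ih => exact ih.mul_cyc h
  | mul_cyc_mul_sgn h _ ih => exact ih.mul_cyc_mul_sgn h

theorem indicator_mem (hu : BlockProd φ s false G u) : indicator 0 s ∈ invariants u := by
  generalize hν : false = ν at hu
  induction hu with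
  | one => exact (fixes_one 0).indicator_mem
  | @mul_cyc s L _ _ _ h hu ih =>
    refine mul_mem_invariants ?_ (mem_invariants_cyc (indicator_bar _ _) (v := 1) fun x _ _ => by
      rw [indicator_pt _ _ (by omega), if_pos (by omega)])
    rw [← indicator_add_indicator (Nat.zero_le s) (by omega : s ≤ s + L + 1)]
    exact add_mem (ih hν) hu.fixes.indicator_mem
  | mul_cyc_mul_sgn => cases hν

end BlockProd

theorem leadCoeff_mul_cyc_mul_jm {f : MonoidAlgebra S[X] (B n)} (hf : f ∈ lengthGraded n S)
    {s L : ℕ} (h : s + L < n) {u : B n} (hu : Fixes s u) :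
    leadCoeff (u * cyc n s L) (f * jm n S (s + L)) =
      ∑ q ∈ Finset.range L, leadCoeff (u * cyc n s q * cyc n (s + q + 1) (L - (q + 1))) f := by
  rw [leadCoeff_mul_jm hf, descents_mul_cyc h hu, Finset.sum_image (injOn_pt_add h.le)]
  refine Finset.sum_congr rfl fun q hq => ?_
  rw [mul_assoc, cyc_mul_reflection h (Finset.mem_range.1 hq), mul_assoc]

theorem leadCoeff_mul_cyc_mul_sgn_mul_jm {f : MonoidAlgebra S[X] (B n)}
    (hf : f ∈ lengthGraded n S) {s L : ℕ} (h : s + L < n) {u : B n} (hu : Fixes s u)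
    (hinv : indicator 0 s ∈ invariants u) :
    leadCoeff (u * cyc n s L * sgn n (s + L)) (f * jm n S (s + L)) =
      leadCoeff (u * cyc n s L) f +
        ∑ q ∈ Finset.range L,
          (leadCoeff (u * cyc n s q * sgn n (s + q) * cyc n (s + q + 1) (L - (q + 1))) f +
            leadCoeff (u * cyc n s q * cyc n (s + q + 1) (L - (q + 1)) * sgn n (s + L)) f) := by
  have disjoint : Disjoint ((Finset.range L).image fun q => pt n (s + q))
      ((Finset.range (L + 1)).image fun q => bar (pt n (s + q))) :=
    Finset.disjoint_left.2 fun a ha hbar => by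
      simpa [((mem_image_bar_pt h).1 hbar).2.2] using ((mem_image_pt h.le).1 ha).2.2
  have injOn_bar : Set.InjOn (fun q => bar (pt n (s + q))) (Finset.range (L + 1)) :=
    fun a ha b hb hab => injOn_pt_add h ha hb (bar_inj.1 hab)
  rw [leadCoeff_mul_jm hf, descents_mul_cyc_mul_sgn h hu hinv, Finset.sum_union disjoint,
    Finset.sum_image (injOn_pt_add h.le), Finset.sum_image injOn_bar, Finset.sum_range_succ,
    ← sgn, mul_assoc (u * cyc n s L), sgn_mul_self, mul_one, Finset.sum_add_distrib, ← add_assoc,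
    add_comm _ (leadCoeff (u * cyc n s L) f)]
  congr 2
  · refine Finset.sum_congr rfl fun q hq => ?_
    simp only [mul_assoc u, cyc_mul_sgn_mul_reflection h (Finset.mem_range.1 hq)]
  · refine Finset.sum_congr rfl fun q hq => ?_
    simp only [mul_assoc u, cyc_mul_sgn_mul_reflection_bar h (Finset.mem_range.1 hq)]

theorem coeff_mul_eq_sum_range (f g : PowerSeries S) (L : ℕ) :
    PowerSeries.coeff L (f * g) = PowerSeries.constantCoeff f * PowerSeries.coeff L g +
      ∑ q ∈ Finset.range L,
        PowerSeries.coeff (q + 1) f * PowerSeries.coeff (L - (q + 1)) g := by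
  rw [PowerSeries.coeff_mul, Finset.Nat.sum_antidiagonal_eq_sum_range_succ
    fun i j => PowerSeries.coeff i f * PowerSeries.coeff j g, Finset.sum_range_succ',
    PowerSeries.coeff_zero_eq_constantCoeff, add_comm, Nat.sub_zero]

omit [NeZero n] in
theorem leadCoeff_mul_aeval_C (w : B n) (f g : MonoidAlgebra S[X] (B n)) (r : S) :
    leadCoeff w (f * aeval g (C r)) = r * leadCoeff w f := by
  rw [aeval_C, ← Algebra.commutes, ← Algebra.smul_def, map_smul, smul_eq_mul]

theorem leadCoeff_eq_zero_of_apply_pt_ne {j : ℕ} (hj : j < n) {f : MonoidAlgebra S[X] (B n)}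
    (hf : f ∈ supportedBelow n S j) {w : B n} (hw : w.1 (pt n j) ≠ pt n j) : leadCoeff w f = 0 := by
  rw [leadCoeff_apply, hf w fun h => hw (h _ (pt_fst hj).ge), coeff_zero]

theorem coeff_aeval_tree_mul_X (φ ψ : S[X]) (L : ℕ) :
    PowerSeries.coeff L (aeval (tree φ) (ψ * X)) = ∑ q ∈ Finset.range L,
      PowerSeries.coeff (q + 1) (tree φ) * PowerSeries.coeff (L - (q + 1)) (aeval (tree φ) ψ) := by
  rw [map_mul, aeval_X, mul_comm, coeff_mul_eq_sum_range, constantCoeff_tree, zero_mul, zero_add]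

theorem coeff_aeval_tree_derivative_mul_X (φ ψ : S[X]) (L : ℕ) :
    PowerSeries.coeff L (aeval (tree φ) (derivative (ψ * X)) * markedTree φ) =
      PowerSeries.coeff L (aeval (tree φ) ψ) + ∑ q ∈ Finset.range L,
        (PowerSeries.coeff (q + 1) (markedTree φ) *
            PowerSeries.coeff (L - (q + 1)) (aeval (tree φ) ψ) +
          PowerSeries.coeff (q + 1) (tree φ) *
            PowerSeries.coeff (L - (q + 1)) (aeval (tree φ) (derivative ψ) * markedTree φ)) := by
  rw [derivative_mul, derivative_X, mul_one, map_add, map_mul (aeval (tree φ)), aeval_X, add_mul,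
    mul_comm _ (tree φ), mul_assoc, mul_comm (aeval (tree φ) ψ), map_add,
    coeff_mul_eq_sum_range (tree φ), coeff_mul_eq_sum_range (markedTree φ), constantCoeff_tree,
    constantCoeff_markedTree, Finset.sum_add_distrib]
  ring

section Recursion

variable {φ : S[X]} {j : ℕ} {F : MonoidAlgebra S[X] (B n)}

theorem leadCoeff_mul_cyc_mul_aeval_jm (hj : j < n) (graded : F ∈ lengthGraded n S)
    (supported : F ∈ supportedBelow n S j)
    (hF : ∀ {ν G u}, BlockProd φ j ν G u → leadCoeff u F = G) (ψ : S[X]) {s L : ℕ}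
    (hsL : s + L = j) {ν : Bool} {G : S} {u : B n} (hu : BlockProd φ s ν G u) :
    leadCoeff (u * cyc n s L) (F * aeval (jm n S j) ψ) =
      G * PowerSeries.coeff L (aeval (tree φ) ψ) := by
  induction ψ using Polynomial.induction_on generalizing s L ν G u with
  | C r =>
    rw [leadCoeff_mul_aeval_C, aeval_C, PowerSeries.algebraMap_apply, Algebra.algebraMap_self_apply,
      PowerSeries.coeff_C, mul_comm]
    obtain rfl | hL := L.eq_zero_or_pos
    · subst hsL
      rw [if_pos rfl, cyc, mul_one, hF hu]
    · rw [leadCoeff_eq_zero_of_apply_pt_ne hj supported, zero_mul, if_neg hL.ne', mul_zero]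
      rw [← hsL, mul_apply, cyc_apply_last, hu.fixes _ (pt_fst (by omega)).ge, Ne,
        pt_inj (by omega) (by omega)]
      omega
  | add ψ χ hψ hχ => rw [map_add, map_add, mul_add, map_add, map_add, hψ hsL hu, hχ hsL hu, mul_add]
  | monomial m r ih =>
    subst hsL
    rw [pow_succ, ← mul_assoc, coeff_aeval_tree_mul_X, map_mul (aeval _), aeval_X,
      ← mul_assoc,
      leadCoeff_mul_cyc_mul_jm (mul_aeval_mem _ (mul_jm_mem_lengthGraded _) graded _) hj hu.fixes,
      Finset.mul_sum]
    refine Finset.sum_congr rfl fun q hq => ?_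
    have hqL := Finset.mem_range.1 hq
    rw [ih (by omega) (hu.mul_cyc (by omega)), mul_assoc]

theorem leadCoeff_mul_cyc_mul_sgn_mul_aeval_jm (hj : j < n) (graded : F ∈ lengthGraded n S)
    (supported : F ∈ supportedBelow n S j)
    (hF : ∀ {ν G u}, BlockProd φ j ν G u → leadCoeff u F = G) (ψ : S[X]) {s L : ℕ}
    (hsL : s + L = j) {G : S} {u : B n} (hu : BlockProd φ s false G u) :
    leadCoeff (u * cyc n s L * sgn n j) (F * aeval (jm n S j) ψ) =
      G * PowerSeries.coeff L (aeval (tree φ) (derivative ψ) * markedTree φ) := by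
  induction ψ using Polynomial.induction_on generalizing s L G u with
  | C r =>
    rw [leadCoeff_mul_aeval_C, leadCoeff_eq_zero_of_apply_pt_ne hj supported]
    · simp
    · rw [← hsL, mul_apply, sgn_apply_self, apply_bar]
      rw [mul_apply, cyc_apply_last, hu.fixes _ (pt_fst (by omega)).ge]
      exact fun h => by simpa using congrArg Prod.snd h
  | add ψ χ hψ hχ =>
    rw [map_add, mul_add, map_add, derivative_add, map_add, add_mul, map_add,
      hψ hsL hu, hχ hsL hu, mul_add]
  | monomial m r ih =>
    subst hsL
    rw [pow_succ, ← mul_assoc, coeff_aeval_tree_derivative_mul_X, map_mul (aeval _), aeval_X,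
      ← mul_assoc,
      leadCoeff_mul_cyc_mul_sgn_mul_jm (mul_aeval_mem _ (mul_jm_mem_lengthGraded _) graded _) hj
        hu.fixes hu.indicator_mem, mul_add, Finset.mul_sum,
      leadCoeff_mul_cyc_mul_aeval_jm hj graded supported hF _ rfl hu]
    congr 1
    refine Finset.sum_congr rfl fun q hq => ?_
    have hqL := Finset.mem_range.1 hq
    rw [leadCoeff_mul_cyc_mul_aeval_jm hj graded supported hF _ (by omega)
      (hu.mul_cyc_mul_sgn (by omega)), ih (by omega) (hu.mul_cyc (by omega)), mul_add, mul_assoc,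
      mul_assoc]

end Recursion

theorem leadCoeff_jmProd {φ : S[X]} {s : ℕ} {ν : Bool} {G : S} {u : B n}
    (hu : BlockProd φ s ν G u) : leadCoeff u (jmProd n φ s) = G := by
  induction s using Nat.strong_induction_on generalizing ν G u with
  | _ s ih =>
    cases hu with
    | one => exact leadCoeff_one_one
    | @mul_cyc s L _ _ _ h hu =>
      rw [jmProd, leadCoeff_mul_cyc_mul_aeval_jm h (jmProd_mem_lengthGraded φ _)
        (jmProd_mem_supportedBelow φ le_rfl h.le) (ih _ (Nat.lt_succ_self _)) φ rfl hu]
      conv_rhs => rw [tree_eq, PowerSeries.coeff_succ_X_mul]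
    | @mul_cyc_mul_sgn s L _ _ h hu =>
      rw [jmProd, leadCoeff_mul_cyc_mul_sgn_mul_aeval_jm h (jmProd_mem_lengthGraded φ _)
        (jmProd_mem_supportedBelow φ le_rfl h.le) (ih _ (Nat.lt_succ_self _)) φ rfl hu]
      conv_rhs =>
        rw [markedTree_eq, map_add, PowerSeries.coeff_one, if_neg (Nat.succ_ne_zero L), zero_add,
          mul_assoc, PowerSeries.coeff_succ_X_mul]

end Blocks

/-! ### Conjugacy of Coxeter elements -/

section Conjugacy

variable {G : Type*} [Group G]

theorem isConj_mul_mul_of_commute {a b x y : G} (hx : Commute (a * b) x)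
    (h : Commute a y ∨ Commute y b) : IsConj (a * (y * b) * x) (a * b * (y * x)) := by
  rcases h with h | h
  · refine isConj_iff.2 ⟨a * b, ?_⟩
    rw [mul_inv_eq_iff_eq_mul, h.left_comm, mul_assoc y, hx.eq]
    simp only [mul_assoc]
  · rw [h.eq]
    simp only [mul_assoc]
    exact IsConj.refl _

theorem commute_prod_map_left {s : ℕ → G} {x : G} {U : List ℕ} (h : ∀ i ∈ U, Commute (s i) x) :
    Commute (U.map s).prod x :=
  Commute.list_prod_left _ _ fun _ hy => by
    obtain ⟨i, hi, rfl⟩ := List.mem_map.1 hy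
    exact h i hi

/-- Move the last generator `s m` to the end, using that `s (m - 1)` is either on its left or on its
right. The factor `x` collects the generators moved before. -/
theorem isConj_prod_of_perm_range {s : ℕ → G} {m : ℕ}
    (hs : ∀ i j, i + 1 < j → j < m → Commute (s i) (s j)) {x : G}
    (hx : ∀ i, i + 1 < m → Commute (s i) x) {U : List ℕ} (hU : U.Perm (List.range m)) :
    IsConj ((U.map s).prod * x) (((List.range m).map s).prod * x) := by
  induction m generalizing x U with
  | zero =>
    rw [List.range_zero] at hU
    rw [hU.eq_nil, List.range_zero]
  | succ m ih =>
    obtain ⟨U₁, U₂, rfl⟩ := List.append_of_mem (hU.mem_iff.2 (List.mem_range.2 m.lt_succ_self))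
    have nodup : (U₁ ++ m :: U₂).Nodup := hU.nodup_iff.2 List.nodup_range
    have perm : (U₁ ++ U₂).Perm (List.range m) := by
      rw [List.range_succ] at hU
      exact (List.perm_middle.symm.trans (hU.trans (List.perm_append_singleton m _))).cons_inv
    have lt_of_mem {i : ℕ} (hi : i ∈ U₁ ++ U₂) : i < m := List.mem_range.1 (perm.mem_iff.1 hi)
    have commute_x : Commute ((U₁.map s).prod * (U₂.map s).prod) x := by
      rw [← List.prod_append, ← List.map_append]
      exact commute_prod_map_left fun i hi => hx i (Nat.succ_lt_succ (lt_of_mem hi))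
    have commute_last : Commute (U₁.map s).prod (s m) ∨ Commute (s m) (U₂.map s).prod := by
      by_cases h : m - 1 ∈ U₁
      · refine Or.inr (commute_prod_map_left fun i hi => hs i m ?_ m.lt_succ_self).symm
        have := lt_of_mem (List.mem_append_right U₁ hi)
        have : i ≠ m - 1 := fun hi' =>
          List.disjoint_of_nodup_append nodup h (List.mem_cons_of_mem _ (hi' ▸ hi))
        omega
      · refine Or.inl (commute_prod_map_left fun i hi => hs i m ?_ m.lt_succ_self)
        have := lt_of_mem (List.mem_append_left U₂ hi)
        have : i ≠ m - 1 := fun hi' => h (hi' ▸ hi)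
        omega
    have conj_last := isConj_mul_mul_of_commute commute_x commute_last
    have conj_rest := ih (fun i j hi hj => hs i j hi (hj.trans m.lt_succ_self)) (x := s m * x)
      (fun i hi => (hs i m hi m.lt_succ_self).mul_right (hx i (hi.trans m.lt_succ_self))) perm
    simp only [List.range_succ, List.map_append, List.prod_append, List.map_cons, List.prod_cons,
      List.map_nil, List.prod_nil, mul_one, mul_assoc] at conj_last conj_rest ⊢
    exact conj_last.trans conj_rest

end Conjugacy

section StdCoxeter

variable {n : ℕ}

theorem perm_ofFn_range (σ : Equiv.Perm (Fin n)) :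
    (List.ofFn fun i => (σ i : ℕ)).Perm (List.range n) := by
  rw [← List.map_coe_finRange_eq_range, ← List.ofFn_eq_map]
  exact Equiv.Perm.ofFn_comp_perm σ fun i : Fin n => (i : ℕ)

variable [NeZero n]

variable (n) in
/-- The generators `simpleB` with natural numbers as indices (meaningful only below `n`). -/
def simpleNat (i : ℕ) : B n :=
  if i + 1 < n then reflection (pt n i) (pt n (i + 1)) else sgn n i

theorem mk_one_eq_pt (i : Fin n) : (i, 1) = pt n i := (eq_pt_iff i.2).2 ⟨rfl, rfl⟩

theorem simpleB_eq_simpleNat (i : Fin n) : simpleB n i = simpleNat n i := by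
  rw [simpleB, simpleNat]
  split_ifs with h
  · rw [signedSwap_eq, mk_one_eq_pt, mk_one_eq_pt]
  · rw [signChange_eq, sgn, reflection_comm, ← mk_one_eq_pt]
    rfl

theorem commute_simpleNat {i j : ℕ} (hij : i + 1 < j) (hj : j < n) :
    Commute (simpleNat n i) (simpleNat n j) := by
  have fst_ne {a b : ℕ} (hab : a < b) (hb : b < n) : (pt n a).1 ≠ (pt n b).1 := by
    rw [Ne, Fin.ext_iff, pt_fst (hab.trans hb), pt_fst hb]
    exact hab.ne
  rw [simpleNat, simpleNat, if_pos (by omega)]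
  split_ifs with h <;> refine commute_reflection_reflection ?_ ?_ ?_ ?_ <;>
    exact fst_ne (by omega) (by omega)

variable (n) in
/-- The Coxeter element `s₁ s₂ ⋯ s_n`. -/
def stdCoxeter : B n := ((List.range n).map (simpleNat n)).prod

theorem prod_map_simpleNat {L : ℕ} (h : L < n) :
    ((List.range L).map (simpleNat n)).prod = cyc n 0 L := by
  induction L with
  | zero => rfl
  | succ L ih =>
    rw [cyc, ← ih (by omega), List.range_succ, List.map_append, List.prod_append,
      List.map_singleton, List.prod_singleton, simpleNat, if_pos h, zero_add]

theorem stdCoxeter_eq : stdCoxeter n = cyc n 0 (n - 1) * sgn n (n - 1) := by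
  have hn := NeZero.pos n
  have range_eq : List.range n = List.range (n - 1) ++ [n - 1] := by
    rw [← List.range_succ, Nat.succ_eq_add_one, Nat.sub_add_cancel hn]
  rw [stdCoxeter, range_eq, List.map_append, List.prod_append, List.map_singleton,
    List.prod_singleton, prod_map_simpleNat (by omega), simpleNat, if_neg (by omega)]

theorem IsCoxeterElement.isConj_stdCoxeter {c : B n} (hc : IsCoxeterElement (simpleB n) c) :
    IsConj c (stdCoxeter n) := by
  obtain ⟨σ, w, rfl⟩ := hc
  have conj_prod := isConj_prod_of_perm_range (fun i j => commute_simpleNat) (x := 1)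
    (fun i _ => Commute.one_right _) (perm_ofFn_range σ)
  rw [mul_one, mul_one, List.map_ofFn] at conj_prod
  simp only [simpleB_eq_simpleNat]
  exact (isConj_iff.2 ⟨w, rfl⟩).symm.trans conj_prod

theorem codim_stdCoxeter : codim (stdCoxeter n) = n := by
  have hn := NeZero.pos n
  have := codim_mul_cyc_mul_sgn (s := 0) (L := n - 1) (by omega) (fixes_one (n := n) 0)
  simp only [one_mul, codim_one, zero_add, Nat.sub_add_cancel hn] at this
  rw [stdCoxeter_eq, this]

theorem IsCoxeterElement.codim_eq {c : B n} (hc : IsCoxeterElement (simpleB n) c) :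
    codim c = n := by
  obtain ⟨g, hg⟩ := isConj_iff.1 hc.isConj_stdCoxeter
  rw [← codim_conj g, hg, codim_stdCoxeter]

theorem leadCoeff_stdCoxeter_jmProd {S : Type*} [CommRing S] [IsAddTorsionFree S]
    (φ : Polynomial S) : leadCoeff (stdCoxeter n) (jmProd n φ n) = (φ ^ n).coeff n := by
  have hn := NeZero.pos n
  have := leadCoeff_jmProd
    (BlockProd.mul_cyc_mul_sgn (L := n - 1) (by omega) (BlockProd.one (n := n) (φ := φ)))
  simp only [zero_add, one_mul, Nat.sub_add_cancel hn] at this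
  rw [stdCoxeter_eq, this, coeff_markedTree]

end StdCoxeter

/-! ### Counting factorizations -/

section Counting

theorem prod_ofFn_sum_single {K G Y : Type*} [CommSemiring K] [Monoid G] [Fintype Y] {m : ℕ}
    (g : Fin m → Y → G) (h : Fin m → Y → K) :
    (List.ofFn fun i => ∑ y, MonoidAlgebra.single (g i y) (h i y)).prod =
      ∑ x : Fin m → Y, MonoidAlgebra.single (List.ofFn fun i => g i (x i)).prod
        (∏ i, h i (x i)) := by
  induction m with
  | zero => simp [MonoidAlgebra.one_def]
  | succ m ih =>
    rw [List.ofFn_succ, List.prod_cons, ih, Finset.sum_mul_sum, ← Finset.sum_product',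
      Finset.univ_product_univ, ← (Fin.consEquiv fun _ => Y).sum_comp]
    refine Finset.sum_congr rfl fun p _ => ?_
    simp [MonoidAlgebra.single_mul_single, Fin.prod_univ_succ, List.ofFn_succ, Fin.consEquiv]

theorem coeff_eq_of_isConj {K G : Type*} [Semiring K] [Group G] {f : MonoidAlgebra K G}
    (hf : ∀ g, Commute (MonoidAlgebra.single g 1) f) {c d : G} (h : IsConj c d) :
    f.coeff c = f.coeff d := by
  obtain ⟨g, rfl⟩ := isConj_iff.1 h
  have := congrArg (fun f => f.coeff (g * c)) (hf g).eq
  simpa only [MonoidAlgebra.coeff_single_mul_apply, MonoidAlgebra.coeff_mul_single_apply, mul_one,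
    one_mul, inv_mul_cancel_left] using this

section CoefficientExtraction

variable {ι R : Type*} [Fintype ι] [CommSemiring R] {n : ℕ}

theorem coeff_coeff_prod_C_X_mul_X_pow {e j : ι → ℕ} [Decidable (e = j)] (hj : ∑ b, j b = n) :
    ((∏ b, (Polynomial.C (MvPolynomial.X b : MvPolynomial ι R) * Polynomial.X) ^ e b).coeff n).coeff
      (Finsupp.equivFunOnFinite.symm j) = if e = j then 1 else 0 := by
  classical
  have prod_eq : ∏ b, (Polynomial.C (MvPolynomial.X b : MvPolynomial ι R) * Polynomial.X) ^ e b =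
      Polynomial.C (MvPolynomial.monomial (Finsupp.equivFunOnFinite.symm e) 1) *
        Polynomial.X ^ ∑ b, e b := by
    simp only [mul_pow, Finset.prod_mul_distrib, Finset.prod_pow_eq_pow_sum, ← map_pow, ← map_prod]
    rw [MvPolynomial.monomial_eq, MvPolynomial.C_1, one_mul,
      Finsupp.prod_fintype _ _ fun _ => pow_zero _]
    rfl
  rw [prod_eq, Polynomial.coeff_C_mul, Polynomial.coeff_X_pow, mul_ite, mul_one, mul_zero,
    apply_ite (MvPolynomial.coeff _), MvPolynomial.coeff_monomial, MvPolynomial.coeff_zero]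
  simp only [EmbeddingLike.apply_eq_iff_eq]
  split_ifs with hn he he <;> first | rfl | exact absurd (he ▸ hj).symm hn

theorem coeff_coeff_prod_one_add_pow (N : ι → ℕ) {j : ι → ℕ} (hj : ∑ b, j b = n) :
    ((∏ b, (1 + Polynomial.C (MvPolynomial.X b : MvPolynomial ι R) *
        Polynomial.X) ^ N b).coeff n).coeff (Finsupp.equivFunOnFinite.symm j) =
      ∏ b, ((N b).choose (j b) : R) := by
  classical
  have coeff_term (p : ι → ℕ) :
      ((∏ b, (Polynomial.C (MvPolynomial.X b : MvPolynomial ι R) * Polynomial.X) ^ p b *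
        ((N b).choose (p b) : Polynomial (MvPolynomial ι R))).coeff n).coeff
          (Finsupp.equivFunOnFinite.symm j) =
        if p = j then ∏ b, ((N b).choose (j b) : R) else 0 := by
    have prod_choose : ∏ b, ((N b).choose (p b) : Polynomial (MvPolynomial ι R)) =
        Polynomial.C (MvPolynomial.C (∏ b, ((N b).choose (p b) : R))) := by simp
    rw [Finset.prod_mul_distrib, prod_choose, Polynomial.coeff_mul_C, mul_comm,
      MvPolynomial.coeff_C_mul, coeff_coeff_prod_C_X_mul_X_pow hj, mul_ite, mul_one, mul_zero]
    exact ite_congr rfl (fun h => by rw [h]) fun _ => rfl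
  simp only [add_comm (1 : Polynomial (MvPolynomial ι R)), add_pow, one_pow, mul_one]
  rw [Finset.prod_univ_sum, Polynomial.finsetSum_coeff, MvPolynomial.coeff_sum]
  simp only [coeff_term]
  rw [Finset.sum_ite_eq']
  split_ifs with h
  · rfl
  · obtain ⟨b, hb⟩ : ∃ b, N b < j b := by simpa [Fintype.mem_piFinset] using h
    refine (Finset.prod_eq_zero (Finset.mem_univ b) ?_).symm
    rw [Nat.choose_eq_zero_of_lt hb, Nat.cast_zero]

end CoefficientExtraction

variable {n : ℕ} {S : Type*} [CommRing S]

theorem lengthGen_top (t : S) : lengthGen n t n =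
    ∑ w : B n, MonoidAlgebra.single w ((Polynomial.C t * Polynomial.X) ^ codim w) := by
  classical
  rw [lengthGen, Finset.filter_true_of_mem fun w _ => fixes_top w]

theorem coeff_lengthGen_top (t : S) (w : B n) :
    (lengthGen n t n).coeff w = (Polynomial.C t * Polynomial.X) ^ codim w := by
  classical
  rw [lengthGen_top, MonoidAlgebra.coeff_sum, Finsupp.finsetSum_apply]
  simp [MonoidAlgebra.coeff_single, Finsupp.single_apply]

theorem single_commute_lengthGen (t : S) (g : B n) :
    Commute (MonoidAlgebra.single g 1) (lengthGen n t n) := by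
  refine MonoidAlgebra.ext (Finsupp.ext fun w => ?_)
  rw [MonoidAlgebra.coeff_single_mul_apply, MonoidAlgebra.coeff_mul_single_apply,
    coeff_lengthGen_top, coeff_lengthGen_top, mul_one, one_mul, ← codim_conj g (g⁻¹ * w),
    mul_inv_cancel_left]

theorem leadCoeff_prod_map_lengthGen_eq_of_isConj (ts : List S) {c d : B n} (h : IsConj c d) :
    leadCoeff c (ts.map fun t => lengthGen n t n).prod =
      leadCoeff d (ts.map fun t => lengthGen n t n).prod := by
  have codim_eq : codim c = codim d := by
    obtain ⟨g, rfl⟩ := isConj_iff.1 h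
    exact (codim_conj g c).symm
  rw [leadCoeff_apply, leadCoeff_apply, codim_eq, coeff_eq_of_isConj _ h]
  refine fun g => Commute.list_prod_right _ _ fun y hy => ?_
  obtain ⟨t, -, rfl⟩ := List.mem_map.1 hy
  exact single_commute_lengthGen t g

/-- The list `t 0` followed by `k` copies of `t 1, …, t l`. -/
def weights {l : ℕ} (t : Fin (l + 1) → S) (k : ℕ) : List S :=
  t 0 :: (List.ofFn fun _ : Fin k => List.ofFn fun a : Fin l => t a.succ).flatten

omit [CommRing S] in
theorem prod_map_weights {M : Type*} [Monoid M] {l : ℕ} (t : Fin (l + 1) → S) (k : ℕ)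
    (f : S → M) :
    ((weights t k).map f).prod =
      f (t 0) *
        (List.ofFn fun _ : Fin k => (List.ofFn fun a : Fin l => f (t a.succ)).prod).prod := by
  rw [weights, List.map_cons, List.prod_cons, List.map_flatten, List.prod_flatten, List.map_ofFn,
    List.map_ofFn]
  simp only [Function.comp_def, List.map_ofFn]

theorem prod_map_weights_one_add_pow {l : ℕ} (t : Fin (l + 1) → S) (k m : ℕ) :
    ((weights t k).map fun r => 1 + Polynomial.C r * Polynomial.X).prod ^ m =
      ∏ b, (1 + Polynomial.C (t b) * Polynomial.X) ^
        (Fin.cons m (fun _ => k * m) : Fin (l + 1) → ℕ) b := by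
  rw [prod_map_weights, List.prod_ofFn, Finset.prod_const, Finset.card_univ, Fintype.card_fin,
    List.prod_ofFn, mul_pow, ← pow_mul, ← Finset.prod_pow, Fin.prod_univ_succ, Fin.cons_zero]
  simp only [Fin.cons_succ]

theorem prod_map_weights_lengthGen {l : ℕ} (t : Fin (l + 1) → S) (k : ℕ) :
    ((weights t k).map fun r => lengthGen n r n).prod =
      ∑ F : Fin k → Fin l → B n, lengthGen n (t 0) n *
        MonoidAlgebra.single (List.ofFn fun i => (List.ofFn (F i)).prod).prod
          (∏ i, ∏ a, (Polynomial.C (t a.succ) * Polynomial.X) ^ codim (F i a)) := by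
  rw [prod_map_weights, ← Finset.mul_sum,
    ← prod_ofFn_sum_single (fun (_ : Fin k) (x : Fin l → B n) => (List.ofFn x).prod)
      fun _ x => ∏ a, (Polynomial.C (t a.succ) * Polynomial.X) ^ codim (x a),
    ← prod_ofFn_sum_single (fun (_ : Fin l) (x : B n) => x)
      fun a x => (Polynomial.C (t a.succ) * Polynomial.X) ^ codim x]
  simp only [lengthGen_top]

theorem leadCoeff_prod_map_weights_lengthGen {l : ℕ} (t : Fin (l + 1) → S) (k : ℕ) (c : B n) :
    leadCoeff c ((weights t k).map fun r => lengthGen n r n).prod =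
      ∑ F : Fin l → Fin k → B n, (∏ b, (Polynomial.C (t b) * Polynomial.X) ^
        factorLengths (simpleB n) c F b).coeff (codim c) := by
  rw [prod_map_weights_lengthGen, map_sum, ← (Equiv.piComm fun _ _ => B n).sum_comp]
  refine Finset.sum_congr rfl fun F _ => ?_
  rw [leadCoeff_apply, MonoidAlgebra.coeff_mul_single_apply, coeff_lengthGen_top,
    Fin.prod_univ_succ, Finset.prod_comm]
  simp only [factorLengths, Fin.cons_zero, Fin.cons_succ, Finset.prod_pow_eq_pow_sum,
    absLength_eq_codim]
  rfl

theorem card_factorLengths_eq [NeZero n] {c : B n} (hc : IsCoxeterElement (simpleB n) c) (k l : ℕ)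
    {j : Fin (l + 1) → ℕ} (hj : ∑ b, j b = n) :
    Nat.card {F : Fin l → Fin k → B n // factorLengths (simpleB n) c F = j} =
      n.choose (j 0) * ∏ a : Fin l, (k * n).choose (j a.succ) := by
  classical
  let t (b : Fin (l + 1)) : MvPolynomial (Fin (l + 1)) ℤ := MvPolynomial.X b
  have generating_eq : ∑ F : Fin l → Fin k → B n, (∏ b, (Polynomial.C (t b) * Polynomial.X) ^
        factorLengths (simpleB n) c F b).coeff n =
      (∏ b, (1 + Polynomial.C (t b) * Polynomial.X) ^
        (Fin.cons n (fun _ => k * n) : Fin (l + 1) → ℕ) b).coeff n := by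
    rw [← prod_map_weights_one_add_pow, ← leadCoeff_stdCoxeter_jmProd,
      ← prod_map_lengthGen _ le_rfl,
      ← leadCoeff_prod_map_lengthGen_eq_of_isConj _ hc.isConj_stdCoxeter,
      leadCoeff_prod_map_weights_lengthGen, hc.codim_eq]
  have coeff_eq := congrArg (MvPolynomial.coeff (Finsupp.equivFunOnFinite.symm j)) generating_eq
  rw [MvPolynomial.coeff_sum, coeff_coeff_prod_one_add_pow _ hj, Fin.prod_univ_succ] at coeff_eq
  simp only [t, coeff_coeff_prod_C_X_mul_X_pow hj, Fin.cons_zero, Fin.cons_succ,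
    Finset.sum_boole] at coeff_eq
  rw [Nat.card_eq_fintype_card, Fintype.card_subtype]
  exact_mod_cast coeff_eq

end Counting

/-! ### Multichains by rank-jump vector -/

section Enumeration

theorem sum_prod_choose {ι : Type*} [DecidableEq ι] (s : Finset ι) (N : ι → ℕ) (m : ℕ) :
    ∑ j ∈ s.finsuppAntidiag m, ∏ i ∈ s, (N i).choose (j i) = (∑ i ∈ s, N i).choose m := by
  have coeff_one_add_X_pow (N m : ℕ) :
      PowerSeries.coeff m ((1 + PowerSeries.X : PowerSeries ℤ) ^ N) = N.choose m := by
    rw [← PowerSeries.binomialSeries_nat (R := ℤ), PowerSeries.binomialSeries_coeff,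
      Ring.choose_natCast, smul_eq_mul, mul_one]
  have coeff_prod_pow := coeff_one_add_X_pow (∑ i ∈ s, N i) m
  rw [← Finset.prod_pow_eq_pow_sum, PowerSeries.coeff_prod] at coeff_prod_pow
  simp only [coeff_one_add_X_pow] at coeff_prod_pow
  exact_mod_cast coeff_prod_pow

variable {n : ℕ} [NeZero n] {c : B n} (hc : IsCoxeterElement (simpleB n) c) (k l : ℕ)

include hc

theorem IsCoxeterElement.absLength_eq : absLength (simpleB n) c = n := by
  rw [absLength_eq_codim, hc.codim_eq]

theorem card_rankJump_eq {j : Fin (l + 1) → ℕ} (hj : ∑ i, j i = n) :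
    Nat.card {P : Multichain (NCk (simpleB n) c k) l // ∀ i, rankJump P i = (j i : ℤ)} =
      n.choose (j 0) * ∏ i : Fin l, (k * n).choose (j i.succ) := by
  rw [Multichain.card_rankJump_eq_card_factorLengths closure_reflections_simpleB hc.absLength_eq hj,
    card_factorLengths_eq hc k l hj]

theorem zeta_eq : zeta (NCk (simpleB n) c k) l = ((k * l + 1) * n).choose n := by
  have card_rankJump : ∀ j ∈ Finset.univ.finsuppAntidiag n,
      Nat.card {P : Multichain (NCk (simpleB n) c k) l // ∀ i, rankJump P i = (j i : ℤ)} =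
        ∏ i, ((Fin.cons n fun _ => k * n : Fin (l + 1) → ℕ) i).choose (j i) := fun j hj => by
    rw [card_rankJump_eq hc k l (Finset.mem_finsuppAntidiag.1 hj).1, Fin.prod_univ_succ]
    simp only [Fin.cons_zero, Fin.cons_succ]
  rw [zeta_eq_sum_card_rankJump hc.absLength_eq, Finset.sum_congr rfl card_rankJump,
    sum_prod_choose, Fin.sum_univ_succ]
  simp only [Fin.cons_zero, Fin.cons_succ, Finset.sum_const, Finset.card_univ, Fintype.card_fin,
    smul_eq_mul]
  congr 1
  ring

omit hc [NeZero n] in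
theorem rankJump_one_eq_iff (P : Multichain (NCk (simpleB n) c k) 1) {i : ℕ} (hi : i ≤ n) :
    (∀ a, rankJump P a = (![i, n - i] a : ℕ)) ↔ (P.1 0).rk = i := by
  have rankJump_zero : rankJump P 0 = (P.1 0).rk := sub_zero _
  have rankJump_one : rankJump P 1 = n - (P.1 0).rk := rfl
  rw [Fin.forall_fin_two, rankJump_zero, rankJump_one]
  simp only [Matrix.cons_val_zero, Matrix.cons_val_one]
  omega

theorem fussNarayana_eq {i : ℕ} (hi : i ≤ n) :
    fussNarayana (simpleB n) c k i = n.choose i * (k * n).choose (n - i) := by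
  let oneEquiv : Multichain (NCk (simpleB n) c k) 1 ≃ NCk (simpleB n) c k :=
    { toFun P := P.1 0
      invFun π := ⟨fun _ => π, fun a b hab => by omega⟩
      left_inv P := Subtype.ext (funext fun a => by rw [Subsingleton.elim a 0])
      right_inv _ := rfl }
  have card_eq := card_rankJump_eq hc k 1 (j := ![i, n - i]) (by simp [hi])
  rw [Fin.prod_univ_one] at card_eq
  exact (Nat.card_congr (oneEquiv.subtypeEquiv fun P => rankJump_one_eq_iff k P hi)).symm.trans
    card_eq

end Enumeration

end FussB

theorem mainTheorem12 (n k : ℕ) (hn : 1 ≤ n) (hk : 1 ≤ k) (c : FussB.B n)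
    (hc : FussB.IsCoxeterElement (FussB.simpleB n) c) :
    (∀ l : ℕ, 1 ≤ l → ∀ j : Fin (l + 1) → ℕ, ∑ i, j i = n →
      Nat.card {P : FussB.Multichain (FussB.NCk (FussB.simpleB n) c k) l //
          ∀ i, FussB.rankJump P i = (j i : ℤ)} =
        n.choose (j 0) * ∏ i : Fin l, (k * n).choose (j i.succ)) ∧
    (∀ l : ℕ, 1 ≤ l →
      FussB.zeta (FussB.NCk (FussB.simpleB n) c k) l = ((k * l + 1) * n).choose n) ∧
    (∀ i : ℕ, i ≤ n →
      FussB.fussNarayana (FussB.simpleB n) c k i = n.choose i * (k * n).choose (n - i)) := by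
  have : NeZero n := ⟨by omega⟩
  exact ⟨fun l _ j hj => FussB.card_rankJump_eq hc k l hj, fun l _ => FussB.zeta_eq hc k l,
    fun i hi => FussB.fussNarayana_eq hc k hi⟩
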